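/- A *plane straight-line graph* consists of a finite set $V$ of points of $\mathbb{R}^2$ (the vertices), some pairs of which are joined by straight segments (the edges), such that an edge contains no vertex other than its two endpoints and two different edges meet at most in a common endpoint. A *mesh* is a plane straight-line graph all of whose bounded faces are triangles (spanned by three pairwise adjacent vertices), such that the interiors of all these triangles are disjoint and any two of them intersect, if at all, in a common vertex or a common edge. A *convex polygon* is a simple closed polygon with at least three distinct vertices that is the boundary of a convex region; straight angles at its vertices are allowed. A polygon *respects* a mesh $M$ if all of its edges are edges of $M$. Polygons that differ only in the choice of the first vertex or of the orientation are regarded as equal. **Theorem.** There is an absolute constant $C$ such that, for every $n$, every mesh $M$ with $n$ vertices has at most $C\cdot 1.62^n$ convex polygons that respect $M$. That is, any mesh with $n$ vertices has $O(1.62^n)$ convex polygons that respect it. -/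

import Mathlib

/-- The Euclidean plane. -/
abbrev Plane : Type := EuclideanSpace ℝ (Fin 2)

/-- A plane straight-line graph: finitely many points of the plane as vertices, some pairs of
which are joined by straight segments, such that an edge contains no vertex besides its two
endpoints, and two different edges meet at most in a common endpoint. -/
structure PlaneGraph where
  /-- The vertices. -/
  verts : Finset Plane
  /-- The adjacency relation. -/
  graph : SimpleGraph Plane
  mem_verts : ∀ a b, graph.Adj a b → a ∈ verts
  vertex_edge : ∀ v ∈ verts, ∀ a b, graph.Adj a b → v ∈ segment ℝ a b → v = a ∨ v = b
  edge_edge : ∀ a b c d, graph.Adj a b → graph.Adj c d → s(a, b) ≠ s(c, d) →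
    segment ℝ a b ∩ segment ℝ c d ⊆ {a, b} ∩ {c, d}

namespace PlaneGraph

/-- The point set of the drawing: all vertices and all edges. -/
def drawing (M : PlaneGraph) : Set Plane :=
  {x | x ∈ M.verts ∨ ∃ a b, M.graph.Adj a b ∧ x ∈ segment ℝ a b}

/-- A bounded face: a bounded connected component of the complement of the drawing. -/
def IsBoundedFace (M : PlaneGraph) (U : Set Plane) : Prop :=
  (∃ x ∈ M.drawingᶜ, U = connectedComponentIn M.drawingᶜ x) ∧ Bornology.IsBounded U

/-- `T` is the vertex set of a triangle of `M`: three vertices, pairwise joined by edges of `M`,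
such that the open triangle spanned by them is a face. -/
def IsTriangle (M : PlaneGraph) (T : Finset Plane) : Prop :=
  M.graph.IsNClique 3 T ∧ M.IsBoundedFace (interior (convexHull ℝ (T : Set Plane)))

/-- A mesh: a plane straight-line graph all of whose bounded faces are triangles, such that the
interiors of the triangles are disjoint, and any two triangles intersect (if at all) in a common
vertex or a common edge. -/
structure IsMesh (M : PlaneGraph) : Prop where
  face_triangle : ∀ U, M.IsBoundedFace U →
    ∃ T, M.IsTriangle T ∧ U = interior (convexHull ℝ (T : Set Plane))
  disjoint_interiors : ∀ T T', M.IsTriangle T → M.IsTriangle T' → T ≠ T' →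
    Disjoint (interior (convexHull ℝ (T : Set Plane)))
      (interior (convexHull ℝ (T' : Set Plane)))
  inter_triangles : ∀ T T', M.IsTriangle T → M.IsTriangle T' →
    convexHull ℝ (T : Set Plane) ∩ convexHull ℝ (T' : Set Plane) =
      convexHull ℝ ((T : Set Plane) ∩ (T' : Set Plane))

end PlaneGraph

namespace Polygon

/-- A simple polygon: at least three vertices, all distinct, and two different sides meet at most
in a common endpoint. -/
structure IsSimple {k : ℕ} (P : Polygon Plane k) : Prop where
  three_le : 3 ≤ k
  injective : Function.Injective P.vertices
  side_side : ∀ i j, i ≠ j → P.edgeSet ℝ i ∩ P.edgeSet ℝ j ⊆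
    {P i, P (finRotate k i)} ∩ {P j, P (finRotate k j)}

/-- A convex polygon: a simple polygon whose boundary curve bounds a convex region. (A vertex may
have a straight angle.) -/
structure IsConvex {k : ℕ} (P : Polygon Plane k) : Prop where
  simple : P.IsSimple
  boundary_eq : P.boundary ℝ = frontier (convexHull ℝ (Set.range P.vertices))

/-- The sides of a polygon, as unordered pairs of points. A simple polygon is determined by its
sides up to the choice of the first vertex and of the orientation. -/
def sides {k : ℕ} (P : Polygon Plane k) : Set (Sym2 Plane) :=
  Set.range fun i => s(P i, P (finRotate k i))

/-- A polygon respects a plane graph if all of its sides are edges of the graph. -/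
def Respects {k : ℕ} (P : Polygon Plane k) (M : PlaneGraph) : Prop :=
  P.sides ⊆ M.graph.edgeSet

end Polygon

/-- The convex polygons that respect `M`, each represented by its set of sides, so that the choice
of the first vertex and of the orientation does not matter. -/
def PlaneGraph.convexPolygons (M : PlaneGraph) : Set (Set (Sym2 Plane)) :=
  {S | ∃ (k : ℕ) (P : Polygon Plane k), P.IsConvex ∧ P.Respects M ∧ S = P.sides}

/-!
The sides of a convex polygon that respects a mesh `M` are exactly the edges of `M` on the boundary
of the region `K` that it spans, so it suffices to count these regions. A region is the convex hull
of some vertices of `M` and is bounded by edges of `M`; hence every face that meets `K` is contained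
in `K` (`IsRegion.triangle_subset`).

Fix a vertex `s` at which `K` lies on one side of a line, and vertices `a` and `b` of `K` on the
two extreme rays of `K` from `s`. This costs a factor `n ^ 3`. Order the vertices by their angle
at `s`. An edge `v o`, with `o` later than `v`, is *short* unless the face in front of it (on the
side of `s`) has its third vertex strictly between `v` and `o`, in which case the edge passes behind
that vertex. The *walk* in `K` starts at `a` and always continues along the farthest short edge
whose end lies in `K`. It visits all vertices of `K` on the boundary chain from `a` to `b`: if an
edge of this chain is not short, then the third vertex of the face in front of it lies in `K`, and
the walk makes a detour through it (`IsWedge.mem_walk`). So the walk determines `K`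
(`IsWedge.eq_convexHull`).

The Fibonacci bound (`card_le_fib`) comes from an induction over families of regions that share an
initial part of the walk up to a vertex `v`. The measure `m` is the number of vertices later than
`v` in some region of the family. Let `w` be the farthest candidate for the next vertex, and split
the family according to whether `w` lies in the region. Both parts lose `w`. In the part that
contains `w`, let `z` be the farthest candidate after `w`, and consider the face `w z x` in front of
the edge `w z`. If `x` is not later than `w`, then `z` is the nearest later neighbour of `w`, every
region of this part contains `z` (`IsWedge.exists_nearest`), and the walk moves on to `z`, so that
this part loses `z` as well. Otherwise `x` is not earlier than `z`, because `w z` is short; then the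
face shows that every region containing `z` contains `w` (`IsWedge.mem_of_leftFace`), and the part
that avoids `w` loses `z` as well. Hence the count `f` satisfies `f m ≤ f (m - 1) + f (m - 2)`.
Since the golden ratio is less than `1.62`, the factor `n ^ 3` is absorbed.
-/

namespace MeshCount

open Set Filter Topology AffineMap
open scoped Classical

/-! ### Orientation of triples of points -/

/-- Twice the signed area of the triangle `p q r`; it is positive when `r` lies strictly to the
left of the directed line from `p` to `q`. -/
def orient (p q r : Plane) : ℝ := (q 0 - p 0) * (r 1 - p 1) - (q 1 - p 1) * (r 0 - p 0)

lemma orient_cycle (p q r : Plane) : orient q r p = orient p q r := by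
  unfold orient; ring

lemma orient_swap (p q r : Plane) : orient p r q = -orient p q r := by
  unfold orient; ring

@[simp] lemma orient_self_left (p q : Plane) : orient p p q = 0 := by
  unfold orient; ring

@[simp] lemma orient_self_right (p q : Plane) : orient p q q = 0 := by
  unfold orient; ring

@[simp] lemma orient_self_outer (p q : Plane) : orient p q p = 0 := by
  unfold orient; ring

/-- The orientation of a triple in terms of the orientations seen from a base point. -/
lemma orient_eq_add (s p q r : Plane) :
    orient p q r = orient s p q + orient s q r + orient s r p := by
  unfold orient; ring

/-- The Plücker relation between four directions seen from one point. -/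
lemma orient_plucker (s a b c d : Plane) :
    orient s a b * orient s c d - orient s a c * orient s b d
      + orient s a d * orient s b c = 0 := by
  unfold orient; ring

lemma lineMap_coord (u v : Plane) (t : ℝ) (i : Fin 2) :
    (lineMap u v t : Plane) i = (1 - t) * u i + t * v i := by
  simp [lineMap_apply]; ring

lemma orient_lineMap (p q u v : Plane) (t : ℝ) :
    orient p q (lineMap u v t) = (1 - t) * orient p q u + t * orient p q v := by
  unfold orient; simp only [lineMap_coord]; ring

lemma orient_combo (p q u v : Plane) {x y : ℝ} (h : x + y = 1) :
    orient p q (x • u + y • v) = x * orient p q u + y * orient p q v := by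
  obtain rfl : x = 1 - y := by linarith
  unfold orient; simp; ring

lemma orient_combo_three (p q u v w : Plane) {x y z : ℝ} (h : x + y + z = 1) :
    orient p q (x • u + y • v + z • w)
      = x * orient p q u + y * orient p q v + z * orient p q w := by
  obtain rfl : x = 1 - y - z := by linarith
  unfold orient; simp; ring

lemma plane_ext {p q : Plane} (h0 : p 0 = q 0) (h1 : p 1 = q 1) : p = q := by
  ext i; fin_cases i <;> assumption

lemma continuous_orient (p q : Plane) : Continuous (orient p q) := by
  unfold orient; fun_prop

lemma convex_orient_nonneg (p q : Plane) : Convex ℝ {r | 0 ≤ orient p q r} := by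
  intro u hu v hv x y hx hy hxy
  simp only [mem_ofPred_eq] at *
  rw [orient_combo p q u v hxy]; positivity

lemma exists_orient_lt {p q : Plane} (hpq : p ≠ q) : ∃ r, orient p q r < 0 := by
  refine ⟨!₂[p 0 + (q 1 - p 1), p 1 - (q 0 - p 0)], ?_⟩
  have : 0 < (q 0 - p 0) ^ 2 + (q 1 - p 1) ^ 2 := by
    by_contra h
    have h0 : q 0 - p 0 = 0 := by nlinarith [sq_nonneg (q 0 - p 0), sq_nonneg (q 1 - p 1)]
    have h1 : q 1 - p 1 = 0 := by nlinarith [sq_nonneg (q 0 - p 0), sq_nonneg (q 1 - p 1)]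
    exact hpq (plane_ext (by linarith) (by linarith))
  unfold orient; simp; nlinarith

/-- An interior point of a set lying weakly to the left of a line lies strictly to its left. -/
lemma orient_pos_of_mem_interior {p q x : Plane} {A : Set Plane} (hpq : p ≠ q)
    (hA : ∀ r ∈ A, 0 ≤ orient p q r) (hx : x ∈ interior A) : 0 < orient p q x := by
  obtain ⟨r, hr⟩ := exists_orient_lt hpq
  have hc : Tendsto (fun t : ℝ => (lineMap x r t : Plane)) (𝓝[>] 0) (𝓝 x) := by
    have : Continuous (fun t : ℝ => (lineMap x r t : Plane)) := lineMap_continuous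
    have h := this.tendsto 0
    simp only [lineMap_apply_zero] at h
    exact h.mono_left nhdsWithin_le_nhds
  have h1 := hc.eventually (mem_interior_iff_mem_nhds.1 hx)
  have h2 : ∀ᶠ t : ℝ in 𝓝[>] 0, t ∈ Ioo (0 : ℝ) 1 := Ioo_mem_nhdsGT one_pos
  obtain ⟨t, ht, ht0, ht1⟩ := (h1.and h2).exists
  have := hA _ ht
  rw [orient_lineMap] at this
  have hx0 : 0 ≤ orient p q x := hA _ (interior_subset hx)
  nlinarith

lemma orient_eq_zero_of_mem_segment {u v p : Plane} (h : p ∈ segment ℝ u v) :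
    orient u v p = 0 := by
  rw [segment_eq_image_lineMap] at h
  obtain ⟨t, -, rfl⟩ := h
  simp [orient_lineMap]

/-- Barycentric coordinates, cleared of denominators. -/
lemma eq_barycentric {a b c : Plane} (h : orient a b c ≠ 0) (p : Plane) :
    p = (orient b c p / orient a b c) • a + (orient c a p / orient a b c) • b
      + (orient a b p / orient a b c) • c := by
  apply plane_ext <;> simp <;> field_simp <;> unfold orient <;> ring

lemma barycentric_sum {a b c : Plane} (h : orient a b c ≠ 0) (p : Plane) :
    orient b c p / orient a b c + orient c a p / orient a b c
      + orient a b p / orient a b c = 1 := by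
  field_simp; unfold orient; ring

lemma combo_three_mem {A : Set Plane} (hA : Convex ℝ A) {u v w : Plane} {x y z : ℝ}
    (hx : 0 ≤ x) (hy : 0 ≤ y) (hz : 0 ≤ z) (h : x + y + z = 1) (hu : u ∈ A) (hv : v ∈ A)
    (hw : w ∈ A) : x • u + y • v + z • w ∈ A := by
  have := hA.sum_mem (t := Finset.univ) (w := ![x, y, z]) (z := ![u, v, w])
    (by intro i _; fin_cases i <;> simpa) (by simpa [Fin.sum_univ_three] using h)
    (by intro i _; fin_cases i <;> simpa)
  simpa [Fin.sum_univ_three] using this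

/-- A closed triangle is the intersection of three closed half-planes. -/
lemma mem_convexHull_triangle {a b c p : Plane} (h : 0 < orient a b c) :
    p ∈ convexHull ℝ ({a, b, c} : Set Plane) ↔
      0 ≤ orient a b p ∧ 0 ≤ orient b c p ∧ 0 ≤ orient c a p := by
  have h1 : orient b c a = orient a b c := orient_cycle _ _ _
  have h2 : orient c a b = orient a b c := by rw [orient_cycle, orient_cycle]
  constructor
  · intro hp
    refine ⟨?_, ?_, ?_⟩
    · refine convexHull_min (t := {r | 0 ≤ orient a b r}) ?_ (convex_orient_nonneg _ _) hp
      rintro x (rfl | rfl | rfl) <;> simp [h.le]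
    · refine convexHull_min (t := {r | 0 ≤ orient b c r}) ?_ (convex_orient_nonneg _ _) hp
      rintro x (rfl | rfl | rfl) <;> simp [h1, h.le]
    · refine convexHull_min (t := {r | 0 ≤ orient c a r}) ?_ (convex_orient_nonneg _ _) hp
      rintro x (rfl | rfl | rfl) <;> simp [h2, h.le]
  · rintro ⟨hc, ha, hb⟩
    rw [eq_barycentric h.ne' p]
    have hs := barycentric_sum h.ne' p
    refine combo_three_mem (convex_convexHull ℝ _) ?_ ?_ ?_ hs ?_ ?_ ?_
    all_goals first | positivity | exact subset_convexHull ℝ _ (by simp)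

/-- An open triangle is the intersection of three open half-planes. -/
lemma mem_interior_triangle {a b c p : Plane} (h : 0 < orient a b c) :
    p ∈ interior (convexHull ℝ ({a, b, c} : Set Plane)) ↔
      0 < orient a b p ∧ 0 < orient b c p ∧ 0 < orient c a p := by
  have hne : a ≠ b ∧ b ≠ c ∧ c ≠ a := by
    refine ⟨?_, ?_, ?_⟩ <;> rintro rfl <;> simp at h
  constructor
  · intro hp
    refine ⟨orient_pos_of_mem_interior hne.1 (fun r hr => ?_) hp,
      orient_pos_of_mem_interior hne.2.1 (fun r hr => ?_) hp,
      orient_pos_of_mem_interior hne.2.2 (fun r hr => ?_) hp⟩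
    · exact ((mem_convexHull_triangle h).1 hr).1
    · exact ((mem_convexHull_triangle h).1 hr).2.1
    · exact ((mem_convexHull_triangle h).1 hr).2.2
  · rintro ⟨h1, h2, h3⟩
    have ho : IsOpen {p | 0 < orient a b p ∧ 0 < orient b c p ∧ 0 < orient c a p} :=
      (isOpen_lt continuous_const (continuous_orient a b)).inter
        ((isOpen_lt continuous_const (continuous_orient b c)).inter
          (isOpen_lt continuous_const (continuous_orient c a)))
    refine interior_maximal ?_ ho ⟨h1, h2, h3⟩
    rintro q ⟨q1, q2, q3⟩
    exact (mem_convexHull_triangle h).2 ⟨q1.le, q2.le, q3.le⟩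

/-- A boundary point of a triangle on the line of one side lies on that side. -/
lemma mem_segment_of_orient_eq_zero {a b c p : Plane} (h : 0 < orient a b c)
    (h0 : orient a b p = 0) (h1 : 0 ≤ orient b c p) (h2 : 0 ≤ orient c a p) :
    p ∈ segment ℝ a b := by
  have e := eq_barycentric h.ne' p
  have hs := barycentric_sum h.ne' p
  rw [h0] at e hs
  simp only [zero_div, zero_smul, add_zero] at e hs
  rw [e]
  exact ⟨_, _, by positivity, by positivity, hs, rfl⟩

/-- The convex hull of a set of collinear points has empty interior. -/
lemma interior_convexHull_eq_empty {A : Set Plane} {p q : Plane} (hpq : p ≠ q)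
    (h : ∀ r ∈ A, orient p q r = 0) : interior (convexHull ℝ A) = ∅ := by
  by_contra hne
  obtain ⟨x, hx⟩ := nonempty_iff_ne_empty.2 hne
  have h1 := orient_pos_of_mem_interior (A := convexHull ℝ A) hpq (fun r hr =>
    convexHull_min (fun y hy => by simp [h y hy]) (convex_orient_nonneg p q) hr) hx
  have hcv : Convex ℝ {r | orient p q r = 0} := by
    intro u hu v hv x y hx hy hxy
    simp only [mem_ofPred_eq] at *
    rw [orient_combo p q u v hxy, hu, hv]; simp
  have h2 : orient p q x = 0 :=
    convexHull_min (t := {r | orient p q r = 0}) h hcv (interior_subset hx)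
  linarith

lemma eventually_affine_pos {A B : ℝ} (hA : 0 < A) :
    ∀ᶠ t : ℝ in 𝓝[>] 0, 0 < (1 - t) * A + t * B := by
  have hc : Continuous fun t : ℝ => (1 - t) * A + t * B := by fun_prop
  have := (hc.tendsto 0).mono_left (nhdsWithin_le_nhds (s := Ioi 0))
  exact this.eventually (lt_mem_nhds (by simpa using hA))

variable {M : PlaneGraph}

/-! ### Faces of a plane graph -/

lemma mem_verts_right {v w : Plane} (h : M.graph.Adj v w) : w ∈ M.verts :=
  M.mem_verts _ _ h.symm

/-- `LeftFace M v w x`: the triangle `v w x` is a bounded face of `M`, and it lies to the left of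
its side directed from `v` to `w`. -/
def LeftFace (M : PlaneGraph) (v w x : Plane) : Prop :=
  M.IsTriangle {v, w, x} ∧ 0 < orient v w x

lemma LeftFace.cycle {v w x : Plane} (h : LeftFace M v w x) : LeftFace M w x v := by
  refine ⟨?_, by rw [orient_cycle]; exact h.2⟩
  have : ({w, x, v} : Finset Plane) = {v, w, x} := by ext y; simp; tauto
  rw [this]; exact h.1

lemma LeftFace.adj {v w x : Plane} (h : LeftFace M v w x) : M.graph.Adj v w := by
  have := h.1.1.isClique
  have hne : v ≠ w := by rintro rfl; simpa using h.2
  exact this (by simp) (by simp) hne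

lemma IsTriangle.interior_subset {T : Finset Plane} (hT : M.IsTriangle T) :
    interior (convexHull ℝ (T : Set Plane)) ⊆ M.drawingᶜ := by
  obtain ⟨-, ⟨x, -, hU⟩, -⟩ := hT
  rw [hU]; exact connectedComponentIn_subset _ _

lemma IsTriangle.interior_nonempty {T : Finset Plane} (hT : M.IsTriangle T) :
    (interior (convexHull ℝ (T : Set Plane))).Nonempty := by
  obtain ⟨-, ⟨x, hx, hU⟩, -⟩ := hT
  rw [hU]; exact ⟨x, mem_connectedComponentIn hx⟩

lemma IsTriangle.exists_leftFace {T : Finset Plane} (hT : M.IsTriangle T) :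
    ∃ v w x, T = {v, w, x} ∧ LeftFace M v w x := by
  obtain ⟨v, w, x, hvw, hvx, hwx, rfl⟩ := SimpleGraph.is3Clique_iff.1 hT.1
  rcases lt_trichotomy (orient v w x) 0 with h | h | h
  · refine ⟨v, x, w, by ext y; simp; tauto, ?_, by rw [orient_swap]; linarith⟩
    have : ({v, x, w} : Finset Plane) = {v, w, x} := by ext y; simp; tauto
    rw [this]; exact hT
  · have := IsTriangle.interior_nonempty hT
    rw [interior_convexHull_eq_empty hvw.ne] at this
    · simp at this
    · intro r hr
      simp at hr
      rcases hr with rfl | rfl | rfl <;> simp [h]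
  · exact ⟨v, w, x, rfl, hT, h⟩

lemma LeftFace.mem_interior {v w x p : Plane} (h : LeftFace M v w x) :
    p ∈ interior (convexHull ℝ ((({v, w, x} : Finset Plane)) : Set Plane)) ↔
      0 < orient v w p ∧ 0 < orient w x p ∧ 0 < orient x v p := by
  rw [← mem_interior_triangle h.2]; simp

lemma LeftFace.notMem_drawing {v w x p : Plane} (h : LeftFace M v w x)
    (h1 : 0 < orient v w p) (h2 : 0 < orient w x p) (h3 : 0 < orient x v p) :
    p ∉ M.drawing :=
  IsTriangle.interior_subset h.1 (h.mem_interior.2 ⟨h1, h2, h3⟩)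

/-- No edge of the graph enters a face from one of its corners. -/
lemma LeftFace.sector {v w x u : Plane} (h : LeftFace M v w x) (hu : M.graph.Adj v u)
    (h1 : 0 < orient v w u) (h2 : 0 < orient v u x) : False := by
  have h3 : 0 < orient w x v := by rw [orient_cycle]; exact h.2
  obtain ⟨t, ht, ht0, ht1⟩ := ((eventually_affine_pos (B := orient w x u) h3).and
    (Ioo_mem_nhdsGT (one_pos (α := ℝ)))).exists
  refine h.notMem_drawing (p := lineMap v u t) ?_ ?_ ?_ (Or.inr ⟨v, u, hu, ?_⟩)
  · rw [orient_lineMap]; simp; positivity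
  · rw [orient_lineMap]; exact ht
  · have : orient x v u = orient v u x := by rw [orient_cycle, orient_cycle]
    rw [orient_lineMap, orient_self_right, this]; simp; positivity
  · rw [segment_eq_image_lineMap]; exact ⟨t, ⟨ht0.le, ht1.le⟩, rfl⟩

/-- The face to the left of a directed edge is unique. -/
lemma LeftFace.unique (hM : M.IsMesh) {v w x y : Plane} (hx : LeftFace M v w x)
    (hy : LeftFace M v w y) : x = y := by
  by_contra hxy
  have hne : ({v, w, x} : Finset Plane) ≠ {v, w, y} := by
    intro he
    have : x ∈ ({v, w, y} : Finset Plane) := by rw [← he]; simp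
    simp only [Finset.mem_insert, Finset.mem_singleton] at this
    rcases this with rfl | rfl | h
    · simpa using hx.2
    · simpa using hx.2
    · exact hxy h
  have hd := hM.disjoint_interiors _ _ hx.1 hy.1 hne
  -- points just to the left of the midpoint of `v w` lie in both triangles
  set m : Plane := lineMap v w (1 / 2 : ℝ) with hm
  have e1 : orient v w m = 0 := by simp [hm, orient_lineMap]
  have key : ∀ z, 0 < orient v w z → 0 < orient w z m ∧ 0 < orient z v m := by
    intro z hz
    have a1 : orient w z v = orient v w z := orient_cycle _ _ _
    have a2 : orient z v w = orient v w z := by rw [orient_cycle, orient_cycle]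
    rw [hm, orient_lineMap, orient_lineMap]; simp [a1, a2]; norm_num [hz]
  obtain ⟨hx1, hx2⟩ := key x hx.2
  obtain ⟨hy1, hy2⟩ := key y hy.2
  obtain ⟨t, ⟨⟨⟨⟨ht1, ht2⟩, ht3⟩, ht4⟩, ht0, -⟩⟩ :=
    ((((eventually_affine_pos (B := orient w x x) hx1).and
    (eventually_affine_pos (B := orient x v x) hx2)).and
    (eventually_affine_pos (B := orient w y x) hy1)).and
    (eventually_affine_pos (B := orient y v x) hy2)).and
    (Ioo_mem_nhdsGT (one_pos (α := ℝ))) |>.exists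
  have h0 : 0 < orient v w (lineMap m x t) := by
    rw [orient_lineMap, e1]; have := hx.2; simp; positivity
  refine (Set.disjoint_left.1 hd) ((hx.mem_interior (p := lineMap m x t)).2 ⟨h0, ?_, ?_⟩)
    (hy.mem_interior.2 ⟨h0, ?_, ?_⟩) <;> rw [orient_lineMap] <;> assumption

/-! ### Convex regions bounded by the graph -/

/-- A convex region of `M`: the convex hull of some vertices of `M`, bounded by edges of `M`. -/
structure IsRegion (M : PlaneGraph) (K : Set Plane) : Prop where
  hull_eq : convexHull ℝ (K ∩ M.verts) = K
  frontier_subset : frontier K ⊆ M.drawing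

lemma IsRegion.convex {K : Set Plane} (hK : IsRegion M K) : Convex ℝ K := by
  rw [← hK.hull_eq]; exact convex_convexHull ℝ _

lemma IsRegion.isCompact {K : Set Plane} (hK : IsRegion M K) : IsCompact K := by
  rw [← hK.hull_eq]
  exact ((M.verts.finite_toSet.subset inter_subset_right).isCompact_convexHull ℝ)

lemma IsRegion.isClosed {K : Set Plane} (hK : IsRegion M K) : IsClosed K := hK.isCompact.isClosed

/-- A preconnected set off the drawing that meets a region lies inside the region. -/
lemma IsRegion.subset_of_preconnected {K U : Set Plane} (hK : IsRegion M K)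
    (hU : IsPreconnected U) (hUd : U ⊆ M.drawingᶜ) {p : Plane} (hpU : p ∈ U) (hpK : p ∈ K) :
    U ⊆ K := by
  have hcov : U ⊆ interior K ∪ Kᶜ := by
    intro q hq
    by_cases hqK : q ∈ K
    · left
      by_contra hqi
      exact hUd hq (hK.frontier_subset ⟨subset_closure hqK, hqi⟩)
    · exact Or.inr hqK
  have hd : Disjoint (interior K) Kᶜ := disjoint_compl_right.mono_left interior_subset
  refine (hU.subset_left_of_subset_union isOpen_interior hK.isClosed.isOpen_compl hd hcov
    ⟨p, hpU, ?_⟩).trans interior_subset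
  exact (hcov hpU).resolve_right fun h => h hpK

lemma IsTriangle.isPreconnected {T : Finset Plane} (hT : M.IsTriangle T) :
    IsPreconnected (interior (convexHull ℝ (T : Set Plane))) := by
  obtain ⟨-, ⟨x, -, hU⟩, -⟩ := hT
  rw [hU]; exact isPreconnected_connectedComponentIn

lemma IsTriangle.convexHull_subset {T : Finset Plane} (hT : M.IsTriangle T) {A : Set Plane}
    (hA : IsClosed A) (h : interior (convexHull ℝ (T : Set Plane)) ⊆ A) :
    convexHull ℝ (T : Set Plane) ⊆ A := by
  have h1 := (convex_convexHull ℝ (T : Set Plane)).closure_interior_eq_closure_of_nonempty_interior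
    (IsTriangle.interior_nonempty hT)
  exact subset_closure.trans (h1 ▸ closure_minimal h hA)

/-- A face that meets a region is contained in the region. -/
lemma IsRegion.triangle_subset {K : Set Plane} (hK : IsRegion M K) {T : Finset Plane}
    (hT : M.IsTriangle T) {p : Plane} (hp : p ∈ interior (convexHull ℝ (T : Set Plane)))
    (hpK : p ∈ K) : convexHull ℝ (T : Set Plane) ⊆ K :=
  IsTriangle.convexHull_subset hT hK.isClosed
    (hK.subset_of_preconnected (IsTriangle.isPreconnected hT) (IsTriangle.interior_subset hT)
      hp hpK)

lemma tendsto_lineMap (p r : Plane) :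
    Tendsto (fun t : ℝ => (lineMap p r t : Plane)) (𝓝[>] 0) (𝓝 p) := by
  have : Continuous (fun t : ℝ => (lineMap p r t : Plane)) := lineMap_continuous
  have h := this.tendsto 0
  simp only [lineMap_apply_zero] at h
  exact h.mono_left nhdsWithin_le_nhds

lemma isClosed_segment (u v : Plane) : IsClosed (segment ℝ u v) := by
  rw [← convexHull_pair]
  exact ((Set.toFinite {u, v}).isCompact_convexHull ℝ).isClosed

/-- If a ray starts inside the drawing, then it starts along a single edge. -/
lemma exists_edge_of_frequently {p r : Plane} (hpr : p ≠ r)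
    (h : ∃ᶠ t : ℝ in 𝓝[>] 0, (lineMap p r t : Plane) ∈ M.drawing) :
    ∃ u w, M.graph.Adj u w ∧ p ∈ segment ℝ u w ∧
      ∃ t : ℝ, 0 < t ∧ (lineMap p r t : Plane) ∈ segment ℝ u w := by
  by_contra hcon
  push Not at hcon
  have hpos : ∀ᶠ t : ℝ in 𝓝[>] 0, 0 < t := eventually_mem_nhdsWithin
  have h1 : ∀ u ∈ M.verts, ∀ᶠ t : ℝ in 𝓝[>] 0, (lineMap p r t : Plane) ≠ u := by
    intro u _
    by_cases hu : u = p
    · subst hu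
      filter_upwards [hpos] with t ht he
      rw [lineMap_eq_left_iff] at he
      rcases he with he | he
      · exact hpr he
      · exact ht.ne' he
    · exact (tendsto_lineMap p r).eventually (isOpen_ne.mem_nhds (Ne.symm hu))
  have h2 : ∀ u ∈ M.verts, ∀ w ∈ M.verts, ∀ᶠ t : ℝ in 𝓝[>] 0,
      M.graph.Adj u w → (lineMap p r t : Plane) ∉ segment ℝ u w := by
    intro u _ w _
    by_cases huw : M.graph.Adj u w
    · by_cases hp : p ∈ segment ℝ u w
      · filter_upwards [hpos] with t ht _
        exact hcon u w huw hp t ht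
      · filter_upwards [(tendsto_lineMap p r).eventually
          ((isClosed_segment u w).isOpen_compl.mem_nhds hp)] with t ht _
        exact ht
    · exact Eventually.of_forall fun t h => absurd h huw
  refine h ?_
  filter_upwards [(Finset.eventually_all M.verts).2 h1, (Finset.eventually_all M.verts).2
    fun u hu => (Finset.eventually_all M.verts).2 (h2 u hu)] with t ht1 ht2 ht
  rcases ht with ht | ⟨u, w, huw, ht⟩
  · exact ht1 _ ht rfl
  · exact ht2 u (M.mem_verts _ _ huw) w (mem_verts_right huw) huw ht

/-- If a segment of a region starts at a point `p` of the drawing and leaves the drawing at once,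
then a face in the region has `p` on its boundary and contains the beginning of the segment. -/
lemma IsRegion.exists_triangle (hM : M.IsMesh) {K : Set Plane} (hK : IsRegion M K) {p r : Plane}
    (hp : p ∈ K) (hr : r ∈ K)
    (h : ∀ᶠ t : ℝ in 𝓝[>] 0, (lineMap p r t : Plane) ∉ M.drawing) :
    ∃ T : Finset Plane, M.IsTriangle T ∧ convexHull ℝ (T : Set Plane) ⊆ K ∧
      p ∈ convexHull ℝ (T : Set Plane) ∧
      ∃ t : ℝ, 0 < t ∧ (lineMap p r t : Plane) ∈ interior (convexHull ℝ (T : Set Plane)) := by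
  obtain ⟨ε, hε0, hε⟩ := (mem_nhdsGT_iff_exists_Ioo_subset).1 (h.and (Ioo_mem_nhdsGT one_pos))
  have hε0 : 0 < ε := hε0
  set S : Set Plane := (fun t : ℝ => (lineMap p r t : Plane)) '' Ioo 0 ε with hS
  have hSd : S ⊆ M.drawingᶜ := by
    rintro _ ⟨t, ht, rfl⟩; exact (hε ht).1
  have hSc : IsPreconnected S :=
    isPreconnected_Ioo.image _ (lineMap_continuous (p := p) (q := r)).continuousOn
  have hSK : S ⊆ K := by
    rintro _ ⟨t, ht, rfl⟩
    have := (hε ht).2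
    exact hK.convex.lineMap_mem hp hr ⟨this.1.le, this.2.le⟩
  have h0 : (lineMap p r (ε / 2) : Plane) ∈ S := ⟨ε / 2, ⟨by linarith, by linarith⟩, rfl⟩
  set U := connectedComponentIn M.drawingᶜ (lineMap p r (ε / 2)) with hU
  have hSU : S ⊆ U := hSc.subset_connectedComponentIn h0 hSd
  have hUK : U ⊆ K := hK.subset_of_preconnected isPreconnected_connectedComponentIn
    (connectedComponentIn_subset _ _) (hSU h0) (hSK h0)
  obtain ⟨T, hT, hUT⟩ := hM.face_triangle U
    ⟨⟨_, hSd h0, rfl⟩, hK.isCompact.isBounded.subset hUK⟩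
  refine ⟨T, hT, IsTriangle.convexHull_subset hT hK.isClosed (hUT ▸ hUK), ?_, ε / 2, by linarith,
    hUT ▸ hSU h0⟩
  have hcl : IsClosed (convexHull ℝ (T : Set Plane)) :=
    (T.finite_toSet.isCompact_convexHull ℝ).isClosed
  refine hcl.mem_of_tendsto (tendsto_lineMap p r) ?_
  filter_upwards [Ioo_mem_nhdsGT hε0] with t ht
  have : (lineMap p r t : Plane) ∈ U := hSU ⟨t, ht, rfl⟩
  rw [hUT] at this
  exact interior_subset this

/-- A point of the drawing on a triangular face lies on one of the sides of the face. -/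
lemma IsTriangle.exists_side {T : Finset Plane} (hT : M.IsTriangle T) {p : Plane}
    (hp : p ∈ convexHull ℝ (T : Set Plane)) (hd : p ∈ M.drawing) :
    ∃ v w x, T = {v, w, x} ∧ LeftFace M v w x ∧ p ∈ segment ℝ v w := by
  obtain ⟨v, w, x, rfl, hF⟩ := IsTriangle.exists_leftFace hT
  have hp' := hp
  simp only [Finset.coe_insert, Finset.coe_singleton] at hp'
  obtain ⟨h1, h2, h3⟩ := (mem_convexHull_triangle hF.2).1 hp'
  have hni : ¬ (0 < orient v w p ∧ 0 < orient w x p ∧ 0 < orient x v p) :=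
    fun hc => hF.notMem_drawing hc.1 hc.2.1 hc.2.2 hd
  rcases h1.eq_or_lt with h1' | h1'
  · exact ⟨v, w, x, rfl, hF, mem_segment_of_orient_eq_zero hF.2 h1'.symm h2 h3⟩
  rcases h2.eq_or_lt with h2' | h2'
  · exact ⟨w, x, v, by ext; simp; tauto, hF.cycle,
      mem_segment_of_orient_eq_zero hF.cycle.2 h2'.symm h3 h1⟩
  rcases h3.eq_or_lt with h3' | h3'
  · exact ⟨x, v, w, by ext; simp; tauto, hF.cycle.cycle,
      mem_segment_of_orient_eq_zero hF.cycle.cycle.2 h3'.symm h1 h2⟩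
  · exact absurd ⟨h1', h2', h3'⟩ hni

/-- If both ends of an edge and a point strictly to its left belong to a region, then so does the
face to the left of the edge. -/
lemma IsRegion.exists_leftFace (hM : M.IsMesh) {K : Set Plane} (hK : IsRegion M K) {v w r : Plane}
    (hvw : M.graph.Adj v w) (hv : v ∈ K) (hw : w ∈ K) (hr : r ∈ K) (h : 0 < orient v w r) :
    ∃ x ∈ K, LeftFace M v w x := by
  set m : Plane := lineMap v w (1 / 2 : ℝ) with hm
  have hmseg : m ∈ segment ℝ v w := by
    rw [segment_eq_image_lineMap]; exact ⟨1 / 2, by norm_num, rfl⟩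
  have hm0 : orient v w m = 0 := orient_eq_zero_of_mem_segment hmseg
  have hmv : m ≠ v := by
    intro he; rw [hm, lineMap_eq_left_iff] at he
    rcases he with he | he
    · exact hvw.ne he
    · norm_num at he
  have hmw : m ≠ w := by
    intro he; rw [hm, lineMap_eq_right_iff] at he
    rcases he with he | he
    · exact hvw.ne he
    · norm_num at he
  have hside : ∀ u u', M.graph.Adj u u' → m ∈ segment ℝ u u' → s(u, u') = s(v, w) := by
    intro u u' huu hmu
    by_contra hne
    have := (M.edge_edge u u' v w huu hvw hne ⟨hmu, hmseg⟩).2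
    rcases this with h | h
    · exact hmv h
    · exact hmw h
  have hmK : m ∈ K := hK.convex.segment_subset hv hw hmseg
  have hmr : m ≠ r := by rintro h'; rw [← h', hm0] at h; exact lt_irrefl _ h
  have hoff : ∀ᶠ t : ℝ in 𝓝[>] 0, (lineMap m r t : Plane) ∉ M.drawing := by
    by_contra hcon
    obtain ⟨u, u', huu, hmu, t, ht, htu⟩ := exists_edge_of_frequently hmr
      ((not_eventually.1 hcon).mono fun _ => not_not.1)
    have hs := hside u u' huu hmu
    have hseg : segment ℝ u u' = segment ℝ v w := by
      rcases Sym2.eq_iff.1 hs with ⟨rfl, rfl⟩ | ⟨rfl, rfl⟩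
      · rfl
      · exact segment_symm _ _ _
    rw [hseg] at htu
    have := orient_eq_zero_of_mem_segment htu
    rw [orient_lineMap, hm0] at this
    have : 0 < t * orient v w r := by positivity
    linarith
  obtain ⟨T, hT, hTK, hmT, t, ht, htT⟩ := hK.exists_triangle hM hmK hr hoff
  obtain ⟨a, b, c, rfl, hF, hab⟩ := IsTriangle.exists_side hT hmT (Or.inr ⟨v, w, hvw, hmseg⟩)
  have hcK : c ∈ K := hTK (subset_convexHull ℝ _ (by simp))
  rcases Sym2.eq_iff.1 (hside a b hF.adj hab) with ⟨rfl, rfl⟩ | ⟨rfl, rfl⟩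
  · exact ⟨c, hcK, hF⟩
  · have h1 := (hF.mem_interior.1 htT).1
    have h2 : orient a b (lineMap m r t) = -orient b a (lineMap m r t) := by
      unfold orient; ring
    have h3 : orient b a (lineMap m r t) = t * orient b a r := by
      rw [orient_lineMap, hm0]; ring
    have : 0 < t * orient b a r := by positivity
    linarith

/-- A face seen from a vertex `v` of a region in a direction that is not along an edge. -/
lemma IsRegion.exists_leftFace_corner (hM : M.IsMesh) {K : Set Plane} (hK : IsRegion M K)
    {v r : Plane} (hvV : v ∈ M.verts) (hv : v ∈ K) (hr : r ∈ K) (hvr : v ≠ r)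
    (h : ∀ u, M.graph.Adj v u → orient v u r ≠ 0) :
    ∃ o ∈ K, ∃ x ∈ K, LeftFace M v o x ∧ 0 < orient v o r ∧ 0 < orient x v r := by
  have hoff : ∀ᶠ t : ℝ in 𝓝[>] 0, (lineMap v r t : Plane) ∉ M.drawing := by
    by_contra hcon
    obtain ⟨u, u', huu, hvu, t, ht, htu⟩ := exists_edge_of_frequently hvr
      ((not_eventually.1 hcon).mono fun _ => not_not.1)
    have h0 := orient_eq_zero_of_mem_segment htu
    rw [orient_lineMap, orient_eq_zero_of_mem_segment hvu, mul_zero, zero_add] at h0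
    have h1 := (mul_eq_zero.1 h0).resolve_left ht.ne'
    rcases M.vertex_edge v hvV u u' huu hvu with rfl | rfl
    · exact h _ huu h1
    · apply h _ huu.symm
      have : orient v u r = -orient u v r := by unfold orient; ring
      rw [this, h1, neg_zero]
  obtain ⟨T, hT, hTK, hmT, t, ht, htT⟩ := hK.exists_triangle hM hv hr hoff
  obtain ⟨a, b, c, rfl, hF, hab⟩ := IsTriangle.exists_side hT hmT (Or.inl hvV)
  have key : ∀ o x, LeftFace M v o x → ({a, b, c} : Finset Plane) = {v, o, x} →
      ∃ o ∈ K, ∃ x ∈ K, LeftFace M v o x ∧ 0 < orient v o r ∧ 0 < orient x v r := by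
    intro o x hF he
    rw [he] at hTK htT
    have hh := hF.mem_interior.1 htT
    rw [orient_lineMap, orient_lineMap x v] at hh
    simp only [orient_self_outer, orient_self_right, mul_zero, zero_add] at hh
    exact ⟨o, hTK (subset_convexHull ℝ _ (by simp)), x, hTK (subset_convexHull ℝ _ (by simp)), hF,
      pos_of_mul_pos_right hh.1 ht.le, pos_of_mul_pos_right hh.2.2 ht.le⟩
  rcases M.vertex_edge v hvV a b hF.adj hab with rfl | rfl
  · exact key b c hF rfl
  · exact key c a hF.cycle (by ext; simp; tauto)

/-! ### Regions seen from one of their corners -/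

/-- The region `K` has a corner `s`, and it is contained in the angle at `s` from the ray through
`a` to the ray through `b`; the points `a`, `b` lie in `K`, and `a` is the last point of `K` on its
ray. -/
structure IsWedge (M : PlaneGraph) (s a b : Plane) (K : Set Plane) : Prop where
  region : IsRegion M K
  s_mem : s ∈ K
  a_mem : a ∈ K
  b_mem : b ∈ K
  a_vert : a ∈ M.verts
  b_vert : b ∈ M.verts
  pos : 0 < orient s a b
  left : ∀ k ∈ K, 0 ≤ orient s a k
  right : ∀ k ∈ K, 0 ≤ orient s k b
  a_last : ∀ t : ℝ, 1 < t → (lineMap s a t : Plane) ∉ K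

/-- The slope of the direction from `v` to `o` in the coordinate system at `v` whose first axis is
perpendicular to the ray from `s` through `v` and whose second axis is that ray. Among the points
`o` on the positive side of the ray, a larger slope means that `o` lies farther behind `v` as seen
from `s`. -/
noncomputable def radialSlope (s v o : Plane) : ℝ :=
  ((v 0 - s 0) * (o 0 - v 0) + (v 1 - s 1) * (o 1 - v 1)) / orient s v o

lemma orient_eq_radialSlope {s v o o' : Plane} (h : 0 < orient s v o) (h' : 0 < orient s v o') :
    ∃ c : ℝ, 0 < c ∧ orient v o' o = c * (radialSlope s v o' - radialSlope s v o) := by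
  have hN : 0 < (v 0 - s 0) ^ 2 + (v 1 - s 1) ^ 2 := by
    by_contra hc
    have h0 : v 0 - s 0 = 0 := by nlinarith [sq_nonneg (v 0 - s 0), sq_nonneg (v 1 - s 1)]
    have h1 : v 1 - s 1 = 0 := by nlinarith [sq_nonneg (v 0 - s 0), sq_nonneg (v 1 - s 1)]
    unfold orient at h; rw [h0, h1] at h; simp at h
  refine ⟨orient s v o * orient s v o' / ((v 0 - s 0) ^ 2 + (v 1 - s 1) ^ 2), by positivity, ?_⟩
  unfold radialSlope
  field_simp
  unfold orient
  ring

lemma orient_pos_iff_radialSlope {s v o o' : Plane} (h : 0 < orient s v o)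
    (h' : 0 < orient s v o') : 0 < orient v o' o ↔ radialSlope s v o < radialSlope s v o' := by
  obtain ⟨c, hc, he⟩ := orient_eq_radialSlope h h'
  rw [he, mul_pos_iff_of_pos_left hc, sub_pos]

/-- A point on the line through `p` and `q`, expressed by a reference point off the line. -/
lemma eq_lineMap_of_orient_eq_zero {p q r z : Plane} (h : orient z p q ≠ 0)
    (h0 : orient p q r = 0) : r = lineMap p q (orient z p r / orient z p q) := by
  apply plane_ext <;> rw [lineMap_coord] <;> field_simp <;> unfold orient at *
  · linear_combination (z 0 - p 0) * h0
  · linear_combination (z 1 - p 1) * h0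

/-- Different edges at `v` have different directions, since no edge passes through a vertex. -/
lemma eq_of_orient_eq_zero {s v o o' : Plane} (h : M.graph.Adj v o) (h' : M.graph.Adj v o')
    (ho : 0 < orient s v o) (ho' : 0 < orient s v o') (h0 : orient v o o' = 0) : o = o' := by
  have key : ∀ o o', M.graph.Adj v o → M.graph.Adj v o' → 0 < orient s v o → 0 < orient s v o' →
      orient v o o' = 0 → orient s v o' ≤ orient s v o → o = o' := by
    intro o o' h h' ho ho' h0 hle
    have he := eq_lineMap_of_orient_eq_zero ho.ne' h0
    have hseg : o' ∈ segment ℝ v o := by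
      rw [segment_eq_image_lineMap]
      exact ⟨_, ⟨by positivity, (div_le_one ho).2 hle⟩, he.symm⟩
    rcases M.vertex_edge o' (mem_verts_right h') v o h hseg with h1 | h1
    · exact absurd h1.symm h'.ne
    · exact h1.symm
  rcases le_total (orient s v o') (orient s v o) with hle | hle
  · exact key o o' h h' ho ho' h0 hle
  · exact (key o' o h' h ho' ho (by rw [orient_swap, h0, neg_zero]) hle).symm

namespace IsWedge

variable {s a b : Plane} {K : Set Plane}

/-- The relation between orientations seen from `s` and coordinates with respect to `a` and `b`. -/
lemma orient_mul (s a b p q : Plane) : orient s a b * orient s p q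
    = orient s p b * orient s a q - orient s a p * orient s q b := by
  unfold orient; ring

lemma trans (hK : IsWedge M s a b K) {u v w : Plane} (hu : u ∈ K) (hv : v ∈ K) (hw : w ∈ K)
    (huv : 0 < orient s u v) (hvw : 0 < orient s v w) : 0 < orient s u w := by
  have hab := hK.pos
  have h1 := orient_mul s a b u v
  have h2 := orient_mul s a b v w
  have h3 := orient_mul s a b u w
  have p1 : 0 < orient s a b * orient s u v := by positivity
  have p2 : 0 < orient s a b * orient s v w := by positivity
  have au := hK.left u hu
  have av := hK.left v hv
  have aw := hK.left w hw
  have ub := hK.right u hu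
  have vb := hK.right v hv
  have wb := hK.right w hw
  have av' : 0 < orient s a v := by
    rcases av.eq_or_lt with h | h
    · rw [← h] at h1; nlinarith
    · exact h
  have vb' : 0 < orient s v b := by
    rcases vb.eq_or_lt with h | h
    · rw [← h] at h2; nlinarith
    · exact h
  have e1 : orient s a u * orient s v b < orient s u b * orient s a v := by linarith
  have e2 : orient s a v * orient s w b < orient s v b * orient s a w := by linarith
  have e3 := mul_lt_mul'' e1 e2 (by positivity) (by positivity)
  have e4 : (orient s a u * orient s w b) * (orient s v b * orient s a v)
      < (orient s u b * orient s a w) * (orient s v b * orient s a v) := by linarith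
  have e5 := lt_of_mul_lt_mul_right e4 (by positivity)
  have e6 : 0 < orient s a b * orient s u w := by linarith
  exact pos_of_mul_pos_right e6 hab.le

lemma pos_left (hK : IsWedge M s a b K) {v w : Plane} (hv : v ∈ K) (hw : w ∈ K)
    (hvw : 0 < orient s v w) : 0 < orient s a w := by
  have hab := hK.pos
  have h1 := orient_mul s a b v w
  have p1 : 0 < orient s a b * orient s v w := by positivity
  rcases (hK.left w hw).eq_or_lt with h | h
  · rw [← h] at h1
    have := mul_nonneg (hK.left v hv) (hK.right w hw)
    linarith
  · exact h

lemma pos_right (hK : IsWedge M s a b K) {v w : Plane} (hv : v ∈ K) (hw : w ∈ K)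
    (hvw : 0 < orient s v w) : 0 < orient s v b := by
  have hab := hK.pos
  have h1 := orient_mul s a b v w
  have p1 : 0 < orient s a b * orient s v w := by positivity
  rcases (hK.right v hv).eq_or_lt with h | h
  · rw [← h] at h1
    have := mul_nonneg (hK.left v hv) (hK.right w hw)
    linarith
  · exact h

/-- The face in front of an edge of a wedge, as seen from its corner, lies in the wedge. -/
lemma exists_front (hM : M.IsMesh) (hK : IsWedge M s a b K) {v w : Plane}
    (hvw : M.graph.Adj v w) (hv : v ∈ K) (hw : w ∈ K) (h : 0 < orient s v w) :
    ∃ x ∈ K, LeftFace M v w x :=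
  hK.region.exists_leftFace hM hvw hv hw hK.s_mem (by rwa [orient_cycle])

/-- Every vertex `v` of a wedge that is not on its last ray has a neighbour `o` in the wedge which
comes later and such that the face in front of the edge `v o` extends back to the ray of `v`. -/
lemma exists_nearest (hM : M.IsMesh) (hK : IsWedge M s a b K) {v : Plane} (hvV : v ∈ M.verts)
    (hv : v ∈ K) (hvb : 0 < orient s v b) :
    ∃ o ∈ K, ∃ x ∈ K, LeftFace M v o x ∧ 0 < orient s v o ∧ orient s v x ≤ 0 := by
  -- a point `r` of the wedge beyond the ray of `v`, close to `s`, in general position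
  have hgen : ∀ u ∈ M.verts, ∀ᶠ δ : ℝ in 𝓝[>] 0,
      M.graph.Adj v u → orient v u (lineMap s b δ) ≠ 0 := by
    intro u _
    rcases lt_trichotomy (orient v u s) 0 with h | h | h
    · filter_upwards [eventually_affine_pos (A := -orient v u s) (B := -orient v u b)
        (by linarith)] with δ hδ _
      rw [orient_lineMap]; intro h0; linarith
    · by_cases hb : orient v u b = 0
      · refine Eventually.of_forall fun δ huv => absurd ?_ huv.ne
        unfold orient at h hb hvb
        apply plane_ext
        · have : (v 0 - u 0) * ((v 0 - s 0) * (b 1 - s 1) - (v 1 - s 1) * (b 0 - s 0)) = 0 := by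
            linear_combination (v 0 - b 0) * h + (s 0 - v 0) * hb
          linarith [(mul_eq_zero.1 this).resolve_right hvb.ne']
        · have : (v 1 - u 1) * ((v 0 - s 0) * (b 1 - s 1) - (v 1 - s 1) * (b 0 - s 0)) = 0 := by
            linear_combination (v 1 - b 1) * h + (s 1 - v 1) * hb
          linarith [(mul_eq_zero.1 this).resolve_right hvb.ne']
      · filter_upwards [eventually_mem_nhdsWithin] with δ hδ _
        have hδ : 0 < δ := hδ
        rw [orient_lineMap, h, mul_zero, zero_add]
        exact mul_ne_zero hδ.ne' hb
    · filter_upwards [eventually_affine_pos (A := orient v u s) (B := orient v u b) h] with δ hδ _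
      rw [orient_lineMap]; exact hδ.ne'
  obtain ⟨δ, hδ, hδ0, hδ1⟩ := (((Finset.eventually_all M.verts).2 hgen).and
    (Ioo_mem_nhdsGT (one_pos (α := ℝ)))).exists
  set r : Plane := lineMap s b δ with hr
  have hrK : r ∈ K := hK.region.convex.lineMap_mem hK.s_mem hK.b_mem ⟨hδ0.le, hδ1.le⟩
  have hvr : 0 < orient s v r := by rw [hr, orient_lineMap]; simp; positivity
  have hne : v ≠ r := by rintro h; rw [← h] at hvr; simp at hvr
  obtain ⟨o, hoK, x, hxK, hF, hor, hxr⟩ := hK.region.exists_leftFace_corner hM hvV hv hrK hne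
    fun u hu => hδ u (mem_verts_right hu) hu
  have hox : 0 < orient s v o ∨ 0 < orient s v x := by
    by_contra hcon
    push Not at hcon
    -- otherwise the angle of the face at `v` would lie on the earlier side of the ray of `v`
    have hp := orient_plucker v o r x s
    rw [orient_cycle s v x, orient_cycle s v r, orient_cycle s v o,
      orient_cycle x v r] at hp
    have h1 := mul_nonneg hor.le (neg_nonneg.2 hcon.2)
    have h2 := mul_pos hF.2 hvr
    have h3 := mul_nonneg (neg_nonneg.2 hcon.1) hxr.le
    linarith
  obtain ⟨y, hyK, hvy, hy⟩ : ∃ y ∈ K, M.graph.Adj v y ∧ 0 < orient s v y := by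
    rcases hox with h | h
    · exact ⟨o, hoK, hF.adj, h⟩
    · exact ⟨x, hxK, hF.cycle.cycle.adj.symm, h⟩
  obtain ⟨o, ho, hmin⟩ := (M.verts.filter fun u => u ∈ K ∧ M.graph.Adj v u ∧ 0 < orient s v u)
    |>.exists_min_image (radialSlope s v)
      ⟨y, Finset.mem_filter.2 ⟨mem_verts_right hvy, hyK, hvy, hy⟩⟩
  obtain ⟨-, hoK, hvo, ho⟩ := Finset.mem_filter.1 ho
  obtain ⟨x, hxK, hF⟩ := hK.exists_front hM hvo hv hoK ho
  refine ⟨o, hoK, x, hxK, hF, ho, ?_⟩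
  by_contra hx
  push Not at hx
  have hvx := hF.cycle.cycle.adj.symm
  have h1 := hmin x (Finset.mem_filter.2 ⟨mem_verts_right hvx, hxK, hvx, hx⟩)
  have h2 := (orient_pos_iff_radialSlope hx ho).1 hF.2
  linarith

end IsWedge

/-- If the face in front of the edge `v o` extends back to the ray of `v`, then `o` is the nearest
of the later neighbours of `v`. -/
lemma LeftFace.nearest {s v o x o' : Plane} (hF : LeftFace M v o x) (ho : 0 < orient s v o)
    (hx : orient s v x ≤ 0) (h' : M.graph.Adj v o') (ho' : 0 < orient s v o') :
    o' = o ∨ 0 < orient v o' o := by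
  rcases lt_trichotomy (orient v o o') 0 with h | h | h
  · right; rw [orient_swap]; linarith
  · exact Or.inl (eq_of_orient_eq_zero hF.adj h' ho ho' h).symm
  · exfalso
    refine hF.sector h' h ?_
    have hp := orient_plucker v o o' x s
    rw [orient_cycle s v x, orient_cycle s v o', orient_cycle s v o] at hp
    have h1 := mul_pos hF.2 ho'
    have h2 := mul_nonneg h.le (neg_nonneg.2 hx)
    have h3 : 0 < orient s v o * orient v o' x := by linarith
    exact pos_of_mul_pos_right h3 ho.le

/-- If the face in front of the edge `w z` extends forward to the ray of `z`, then a wedge that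
contains `z` also contains `w`. -/
lemma IsWedge.mem_of_leftFace {s a b : Plane} {K : Set Plane} (hK : IsWedge M s a b K)
    {w z x : Plane} (hF : LeftFace M w z x) (hwz : 0 < orient s w z) (hzx : 0 ≤ orient s z x)
    (haz : 0 < orient s a z) (hz : z ∈ K) : w ∈ K := by
  have hzs : 0 < orient w z s := by rwa [orient_cycle]
  have hzxs : 0 ≤ orient z x s := by rwa [orient_cycle]
  -- a point `r` of the wedge just before the ray of `z`, close to `s`
  obtain ⟨δ, hδ0, hδ1, h1, h2⟩ : ∃ δ : ℝ, 0 < δ ∧ δ < 1 ∧ 0 < orient w z (lineMap s a δ) ∧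
      0 < orient z x (lineMap s a δ) := by
    have e1 := eventually_affine_pos (B := orient w z a) hzs
    rcases hzx.eq_or_lt with h | h
    · -- here `x` lies on the ray of `z`, in front of `z`
      have hax : 0 < orient z x a := by
        have p1 := orient_plucker s a w z x
        have p2 := orient_eq_add s w z x
        have p3 := orient_eq_add s z x a
        rw [← h] at p1 p2 p3
        have p4 : orient s x w = -orient s w x := by unfold orient; ring
        have p5 : orient s x a = -orient s a x := by unfold orient; ring
        have hF2 := hF.2
        have p6 : orient s a z * orient s w x < orient s a z * orient s w z :=
          mul_lt_mul_of_pos_left (by linarith) haz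
        have p7 : orient s a x * orient s w z < orient s a z * orient s w z := by linarith
        have p8 := lt_of_mul_lt_mul_right p7 hwz.le
        linarith
      obtain ⟨δ, hδ, hδ0, hδ1⟩ := (e1.and (Ioo_mem_nhdsGT (one_pos (α := ℝ)))).exists
      refine ⟨δ, hδ0, hδ1, by rwa [orient_lineMap], ?_⟩
      rw [orient_lineMap]
      have := mul_nonneg (sub_nonneg.2 hδ1.le) hzxs
      have := mul_pos hδ0 hax
      linarith
    · have hzxs' : 0 < orient z x s := by rwa [orient_cycle]
      have e2 := eventually_affine_pos (B := orient z x a) hzxs'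
      obtain ⟨δ, ⟨hδ, hδ'⟩, hδ0, hδ1⟩ := ((e1.and e2).and
        (Ioo_mem_nhdsGT (one_pos (α := ℝ)))).exists
      exact ⟨δ, hδ0, hδ1, by rwa [orient_lineMap], by rwa [orient_lineMap]⟩
  set r : Plane := lineMap s a δ
  have hrK : r ∈ K := hK.region.convex.lineMap_mem hK.s_mem hK.a_mem ⟨hδ0.le, hδ1.le⟩
  have hxwz : 0 < orient x w z := by rw [orient_cycle, orient_cycle]; exact hF.2
  obtain ⟨t, ht, ht0, ht1⟩ := ((eventually_affine_pos (B := orient x w r) hxwz).and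
    (Ioo_mem_nhdsGT (one_pos (α := ℝ)))).exists
  have hint := (hF.mem_interior (p := lineMap z r t)).2 ⟨by rw [orient_lineMap]; simp; positivity,
    by rw [orient_lineMap]; simp; positivity, by rwa [orient_lineMap]⟩
  exact hK.region.triangle_subset hF.1 hint
    (hK.region.convex.lineMap_mem hz hrK ⟨ht0.le, ht1.le⟩) (subset_convexHull ℝ _ (by simp))

variable {s a b : Plane} {K : Set Plane}

/-! ### The boundary chain of a wedge -/

/-- From a boundary vertex `c` of a wedge, seen from its corner, the boundary continues along an
edge `c d` of the graph. -/
lemma IsWedge.exists_next_corner (hK : IsWedge M s a b K) {c : Plane} (hcV : c ∈ M.verts)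
    (hc : c ∈ K) (hlast : ∀ t : ℝ, 1 < t → (lineMap s c t : Plane) ∉ K) (hcb : 0 < orient s c b) :
    ∃ d ∈ K, M.graph.Adj c d ∧ 0 < orient s c d ∧ (∀ k ∈ K, 0 ≤ orient c d k) ∧
      ∀ t : ℝ, 1 < t → (lineMap s d t : Plane) ∉ K := by
  -- the farthest direction, and the nearest vertex in that direction
  obtain ⟨d, hd, hmax⟩ := (M.verts.filter fun u => u ∈ K ∧ 0 < orient s c u).exists_max_image
    (fun u => toLex (radialSlope s c u, -orient s c u))
    ⟨b, Finset.mem_filter.2 ⟨hK.b_vert, hK.b_mem, hcb⟩⟩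
  obtain ⟨hdV, hdK, hcd⟩ := Finset.mem_filter.1 hd
  have hcs : orient c d s = orient s c d := orient_cycle _ _ _
  have hsupp : ∀ u ∈ M.verts, u ∈ K → 0 ≤ orient c d u := by
    intro u huV huK
    rcases lt_or_ge 0 (orient s c u) with hu | hu
    · have h1 := hmax u (Finset.mem_filter.2 ⟨huV, huK, hu⟩)
      rw [Prod.Lex.toLex_le_toLex] at h1
      have h2 : radialSlope s c u ≤ radialSlope s c d := by
        rcases h1 with h | h
        · exact h.le
        · exact h.1.le
      obtain ⟨k, hk, he⟩ := orient_eq_radialSlope hu hcd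
      rw [he]; exact mul_nonneg hk.le (by linarith)
    · by_contra hneg
      push Not at hneg
      -- the segment from `u` to `d` crosses the ray of `c` behind `c`
      have hpos : 0 < orient s c d - orient s c u := by linarith
      set τ : ℝ := -orient s c u / (orient s c d - orient s c u) with hτ
      have hτ0 : 0 ≤ τ := div_nonneg (by linarith) hpos.le
      have hτ1 : τ < 1 := (div_lt_one hpos).2 (by linarith)
      set p : Plane := lineMap u d τ with hp
      have hpK : p ∈ K := hK.region.convex.lineMap_mem huK hdK ⟨hτ0, hτ1.le⟩
      have hp0 : orient s c p = 0 := by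
        rw [hp, orient_lineMap, hτ]; field_simp; ring
      have hpn : orient c d p < 0 := by
        rw [hp, orient_lineMap, orient_self_right, mul_zero, add_zero]
        exact mul_neg_of_pos_of_neg (by linarith) hneg
      have hdsc : orient d s c = orient s c d := by rw [orient_cycle, orient_cycle]
      have he := eq_lineMap_of_orient_eq_zero (z := d) (by rw [hdsc]; exact hcd.ne') hp0
      refine hlast (orient d s p / orient d s c) ?_ (he ▸ hpK)
      by_contra hle
      push Not at hle
      rw [he, orient_lineMap, orient_self_outer, mul_zero, add_zero, hcs] at hpn
      have := mul_nonneg (sub_nonneg.2 hle) hcd.le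
      linarith
  have hsuppK : ∀ k ∈ K, 0 ≤ orient c d k := by
    intro k hk
    rw [← hK.region.hull_eq] at hk
    exact convexHull_min (fun u hu => hsupp u hu.2 hu.1) (convex_orient_nonneg c d) hk
  have hne : c ≠ d := by rintro rfl; simp at hcd
  have hfreq : ∃ᶠ t : ℝ in 𝓝[>] 0, (lineMap c d t : Plane) ∈ M.drawing := by
    refine Eventually.frequently ?_
    filter_upwards [Ioo_mem_nhdsGT (one_pos (α := ℝ))] with t ht
    refine hK.region.frontier_subset ⟨subset_closure
      (hK.region.convex.lineMap_mem hc hdK ⟨ht.1.le, ht.2.le⟩), fun hi => ?_⟩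
    have := orient_pos_of_mem_interior hne hsuppK hi
    rw [orient_lineMap] at this
    simp at this
  obtain ⟨u, w, huw, hcu, t, ht, htu⟩ := exists_edge_of_frequently hne hfreq
  obtain ⟨y, hcy, hty⟩ : ∃ y, M.graph.Adj c y ∧ (lineMap c d t : Plane) ∈ segment ℝ c y := by
    rcases M.vertex_edge c hcV u w huw hcu with rfl | rfl
    · exact ⟨w, huw, htu⟩
    · exact ⟨u, huw.symm, by rwa [segment_symm]⟩
  have hcdy : orient c d y = 0 := by
    have := orient_eq_zero_of_mem_segment hty
    rw [orient_lineMap, orient_self_outer, mul_zero, zero_add] at this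
    rw [orient_swap, (mul_eq_zero.1 this).resolve_left ht.ne', neg_zero]
  have hy : 0 < orient s c y := by
    rw [segment_eq_image_lineMap] at hty
    obtain ⟨τ, ⟨hτ, -⟩, he⟩ := hty
    have : orient s c (lineMap c y τ) = orient s c (lineMap c d t) := by rw [he]
    simp only [orient_lineMap, orient_self_right, mul_zero, zero_add] at this
    have h1 : 0 < τ * orient s c y := by rw [this]; positivity
    exact pos_of_mul_pos_right h1 hτ
  have hyd : y = d := by
    rcases le_or_gt (orient s c y) (orient s c d) with hle | hlt
    · have he := eq_lineMap_of_orient_eq_zero hcd.ne' hcdy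
      have hyK : y ∈ K := by
        rw [he]
        exact hK.region.convex.lineMap_mem hc hdK ⟨by positivity, (div_le_one hcd).2 hle⟩
      have h1 := hmax y (Finset.mem_filter.2 ⟨mem_verts_right hcy, hyK, hy⟩)
      rw [Prod.Lex.toLex_le_toLex] at h1
      obtain ⟨k, hk, hke⟩ := orient_eq_radialSlope hy hcd
      have h2 : radialSlope s c d = radialSlope s c y := by
        rw [hcdy] at hke
        linarith [(mul_eq_zero.1 hke.symm).resolve_left hk.ne']
      have h3 : orient s c y = orient s c d := by
        rcases h1 with h | h
        · simp only [h2] at h; exact absurd h (lt_irrefl _)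
        · have := h.2; simp only at this; linarith
      rw [he, h3, div_self hcd.ne', lineMap_apply_one]
    · have he := eq_lineMap_of_orient_eq_zero hy.ne' (by rw [orient_swap, hcdy, neg_zero])
      have hseg : d ∈ segment ℝ c y := by
        rw [segment_eq_image_lineMap]
        exact ⟨_, ⟨by positivity, (div_le_one hy).2 hlt.le⟩, he.symm⟩
      rcases M.vertex_edge d hdV c y hcy hseg with h | h
      · exact absurd h.symm hne
      · exact h.symm
  refine ⟨d, hdK, hyd ▸ hcy, hcd, hsuppK, fun t ht htK => ?_⟩
  have := hsuppK _ htK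
  rw [orient_lineMap, orient_self_right, mul_zero, add_zero, hcs] at this
  nlinarith

/-! ### Short edges and the walk along a wedge -/

/-- A short edge: an edge from `v` to a later vertex `o`, as seen from `s`, that does not pass
behind the third vertex of the face in front of it. -/
def ShortEdge (M : PlaneGraph) (s v o : Plane) : Prop :=
  M.graph.Adj v o ∧ 0 < orient s v o ∧
    ¬ ∃ x, LeftFace M v o x ∧ 0 < orient s v x ∧ 0 < orient s x o

/-- The walk in the region `K` goes from `u` to the farthest vertex `w` of `K` that is joined to
`u` by a short edge. -/
def IsStep (M : PlaneGraph) (s : Plane) (K : Set Plane) (u w : Plane) : Prop :=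
  ShortEdge M s u w ∧ w ∈ K ∧ ∀ w', ShortEdge M s u w' → 0 < orient u w' w → w' ∉ K

/-- If an edge from a vertex `u` of the walk to a vertex `c` of the wedge has no short edge of the
wedge behind it, then the walk visits `c`: unless the edge is short, the walk makes a detour through
the third vertex of the face in front of it. -/
lemma IsWedge.mem_walk (hM : M.IsMesh) (hK : IsWedge M s a b K) {L : Finset Plane}
    (hLK : ∀ u ∈ L, u ∈ K) (hL : ∀ u ∈ L, ∀ c, IsStep M s K u c → c ∈ L) (n : ℕ) :
    ∀ u ∈ L, ∀ c ∈ K, M.graph.Adj u c → 0 < orient s u c →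
      (∀ w', ShortEdge M s u w' → 0 < orient u w' c → w' ∉ K) →
      (M.verts.filter fun y => 0 < orient s u y ∧ 0 < orient s y c).card ≤ n → c ∈ L := by
  induction n using Nat.strong_induction_on with
  | _ n ih =>
  intro u hu c hc huc hpos hfar hn
  by_cases hshort : ShortEdge M s u c
  · exact hL u hu c ⟨hshort, hc, hfar⟩
  obtain ⟨x, hF, hux, hxc⟩ : ∃ x, LeftFace M u c x ∧ 0 < orient s u x ∧ 0 < orient s x c := by
    by_contra hcon; exact hshort ⟨huc, hpos, hcon⟩
  have hxK : x ∈ K := by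
    obtain ⟨y, hyK, hFy⟩ := hK.exists_front hM huc (hLK u hu) hc hpos
    rwa [hF.unique hM hFy]
  have hxu : M.graph.Adj x u := hF.cycle.cycle.adj
  have hxV : x ∈ M.verts := M.mem_verts _ _ hxu
  have hcard : ∀ (p q : Plane), (∀ y, 0 < orient s p y → 0 < orient s y q →
      0 < orient s u y ∧ 0 < orient s y c ∧ y ≠ x) →
      (M.verts.filter fun y => 0 < orient s p y ∧ 0 < orient s y q).card < n := by
    intro p q h
    refine lt_of_lt_of_le (Finset.card_lt_card ?_) hn
    rw [Finset.ssubset_iff_of_subset]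
    · refine ⟨x, Finset.mem_filter.2 ⟨hxV, hux, hxc⟩, fun hx => ?_⟩
      have := (Finset.mem_filter.1 hx).2
      exact (h x this.1 this.2).2.2 rfl
    · intro y hy
      obtain ⟨h0, h1, h2⟩ := Finset.mem_filter.1 hy
      exact Finset.mem_filter.2 ⟨h0, (h y h1 h2).1, (h y h1 h2).2.1⟩
  have hxL : x ∈ L := by
    refine ih _ (hcard u x fun y h1 h2 => ⟨h1, ?_, ?_⟩) u hu x hxK hxu.symm hux ?_ le_rfl
    · have hp := orient_plucker s u y x c
      have q1 := mul_pos h1 hxc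
      have q2 := mul_pos hpos h2
      have q3 : 0 < orient s u x * orient s y c := by
        have : orient s y x * orient s u c = orient s u c * orient s y x := mul_comm _ _
        linarith
      exact pos_of_mul_pos_right q3 hux.le
    · rintro rfl; simp at h2
    · intro w' hw' hw'x hw'K
      rcases lt_trichotomy (orient u w' c) 0 with h | h | h
      · exact hF.sector hw'.1 (by rw [orient_swap]; linarith) hw'x
      · have := eq_of_orient_eq_zero hw'.1 huc hw'.2.1 hpos h
        exact hshort (this ▸ hw')
      · exact hfar w' hw' h hw'K
  refine ih _ (hcard x c fun y h1 h2 => ⟨?_, h2, ?_⟩) x hxL c hc hF.cycle.adj.symm hxc ?_ le_rfl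
  · have hp := orient_plucker s u x y c
    have q1 := mul_pos hux h2
    have q2 := mul_pos hpos h1
    have q3 : 0 < orient s x c * orient s u y := by
      have : orient s x c * orient s u y = orient s u y * orient s x c := mul_comm _ _
      linarith
    exact pos_of_mul_pos_right q3 hxc.le
  · rintro rfl; simp at h1
  · -- the face `u c x` fills the angle at `x` behind the edge `x c`
    intro w' hw' hw'c _
    refine hF.cycle.cycle.sector hw'.1 ?_ hw'c
    have hp := orient_plucker x u w' c s
    rw [orient_cycle s x c, orient_cycle s x w'] at hp
    have e1 : orient x u s = -orient s u x := by unfold orient; ring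
    rw [e1] at hp
    have q1 := mul_pos hF.cycle.cycle.2 hw'.2.1
    have q2 := mul_pos hux hw'c
    have q3 : 0 < orient s x c * orient x u w' := by
      have : orient s x c * orient x u w' = orient x u w' * orient s x c := mul_comm _ _
      linarith
    exact pos_of_mul_pos_right q3 hxc.le

/-- A wedge is the convex hull of its corner and of the vertices of a complete walk. -/
lemma IsWedge.eq_convexHull (hM : M.IsMesh) (hK : IsWedge M s a b K) {L : Finset Plane}
    (haL : a ∈ L) (hLK : ∀ u ∈ L, u ∈ K) (hLV : ∀ u ∈ L, u ∈ M.verts)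
    (hL : ∀ u ∈ L, ∀ c, IsStep M s K u c → c ∈ L) :
    K = convexHull ℝ (insert s (L : Set Plane)) := by
  have hsub : insert s (L : Set Plane) ⊆ K := by
    rintro y (rfl | hy)
    · exact hK.s_mem
    · exact hLK y hy
  refine subset_antisymm ?_ (convexHull_min hsub hK.region.convex)
  suffices h : ∀ u ∈ M.verts, u ∈ K → ∀ (n : ℕ), ∀ c ∈ L,
      (∀ t : ℝ, 1 < t → (lineMap s c t : Plane) ∉ K) → (0 < orient s a c ∨ 0 < orient s c b) →
      0 ≤ orient s c u → (L.filter fun y => 0 < orient s c y).card ≤ n →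
      u ∈ convexHull ℝ (insert s (L : Set Plane)) by
    have h' : K ∩ M.verts ⊆ convexHull ℝ (insert s (L : Set Plane)) := fun u hu =>
      h u hu.2 hu.1 _ a haL hK.a_last (Or.inr hK.pos) (hK.left u hu.1) le_rfl
    have := convexHull_min h' (convex_convexHull ℝ _)
    rwa [hK.region.hull_eq] at this
  intro u huV huK n
  induction n using Nat.strong_induction_on with
  | _ n ih =>
  intro c hcL hlast hcab hcu hn
  have hcK := hLK c hcL
  rcases hcu.eq_or_lt with hcu | hcu
  · -- `u` lies on the ray of `c`, and `c` is the last point on this ray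
    obtain ⟨τ, hτ, he⟩ : ∃ τ : ℝ, 0 ≤ τ ∧ u = lineMap s c τ := by
      rcases hcab with h | h
      · refine ⟨orient a s u / orient a s c, ?_,
          eq_lineMap_of_orient_eq_zero (z := a) ?_ hcu.symm⟩
        · have e1 : orient a s u = -orient s a u := by unfold orient; ring
          have e2 : orient a s c = -orient s a c := by unfold orient; ring
          rw [e1, e2, neg_div_neg_eq]
          exact div_nonneg (hK.left u huK) h.le
        · have e2 : orient a s c = -orient s a c := by unfold orient; ring
          rw [e2]; linarith
      · refine ⟨orient b s u / orient b s c, ?_,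
          eq_lineMap_of_orient_eq_zero (z := b) ?_ hcu.symm⟩
        · rw [← orient_cycle b s u, ← orient_cycle b s c]
          exact div_nonneg (hK.right u huK) h.le
        · rw [← orient_cycle b s c]; exact h.ne'
    have hτ1 : τ ≤ 1 := by
      by_contra h
      push Not at h
      exact hlast τ h (he ▸ huK)
    rw [he]
    exact (convex_convexHull ℝ _).lineMap_mem (subset_convexHull ℝ _ (mem_insert _ _))
      (subset_convexHull ℝ _ (mem_insert_of_mem _ hcL)) ⟨hτ, hτ1⟩
  · obtain ⟨d, hdK, hcd, hcd0, hsupp, hdlast⟩ :=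
      hK.exists_next_corner (hLV c hcL) hcK hlast (hK.pos_right hcK huK hcu)
    have hdL : d ∈ L := by
      refine hK.mem_walk hM hLK hL _ c hcL d hdK hcd hcd0 (fun w' _ hw' hw'K => ?_) le_rfl
      have := hsupp w' hw'K
      rw [orient_swap] at hw'
      linarith
    rcases le_or_gt 0 (orient s d u) with hdu | hdu
    · refine ih _ (lt_of_lt_of_le (Finset.card_lt_card ?_) hn) d hdL hdlast
        (Or.inl (hK.pos_left hcK hdK hcd0)) hdu le_rfl
      rw [Finset.ssubset_iff_of_subset]
      · exact ⟨d, Finset.mem_filter.2 ⟨hdL, hcd0⟩, by simp⟩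
      · intro y hy
        obtain ⟨h1, h2⟩ := Finset.mem_filter.1 hy
        exact Finset.mem_filter.2 ⟨h1, hK.trans hcK hdK (hLK y h1) hcd0 h2⟩
    · have htri : u ∈ convexHull ℝ ({s, c, d} : Set Plane) := by
        refine (mem_convexHull_triangle hcd0).2 ⟨hcu.le, hsupp u huK, ?_⟩
        have : orient d s u = -orient s d u := by unfold orient; ring
        rw [this]; linarith
      refine convexHull_mono ?_ htri
      rintro y (rfl | rfl | rfl)
      · exact mem_insert _ _
      · exact mem_insert_of_mem _ hcL
      · exact mem_insert_of_mem _ hdL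

/-! ### Counting wedges -/

/-- An initial part of the walk in the region `K` from `a`, ending at `v`: the set `L` contains
`a` and `v`, and with each vertex other than `v` also its successor. -/
structure IsWalk (M : PlaneGraph) (s a : Plane) (K : Set Plane) (v : Plane) (L : Finset Plane) :
    Prop where
  a_mem : a ∈ L
  v_mem : v ∈ L
  subset : ∀ u ∈ L, u ∈ K ∧ u ∈ M.verts
  step : ∀ u ∈ L, u = v ∨ ∃ w ∈ L, IsStep M s K u w

lemma IsWalk.extend {v w : Plane} {L : Finset Plane} (h : IsWalk M s a K v L)
    (hw : IsStep M s K v w) : IsWalk M s a K w (insert w L) := by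
  refine ⟨Finset.mem_insert_of_mem h.a_mem, Finset.mem_insert_self _ _, ?_, ?_⟩
  · intro u hu
    rcases Finset.mem_insert.1 hu with rfl | hu
    · exact ⟨hw.2.1, mem_verts_right hw.1.1⟩
    · exact h.subset u hu
  · intro u hu
    rcases Finset.mem_insert.1 hu with rfl | hu
    · exact Or.inl rfl
    · right
      rcases h.step u hu with rfl | ⟨y, hy, hs⟩
      · exact ⟨w, Finset.mem_insert_self _ _, hw⟩
      · exact ⟨y, Finset.mem_insert_of_mem hy, hs⟩

/-- The walk is determined: a vertex has at most one successor. -/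
lemma IsStep.unique {u w w' : Plane} (h : IsStep M s K u w) (h' : IsStep M s K u w') : w = w' := by
  rcases lt_trichotomy (orient u w w') 0 with h1 | h1 | h1
  · exact absurd h'.2.1 (h.2.2 w' h'.1 (by rw [orient_swap]; linarith))
  · exact eq_of_orient_eq_zero h.1.1 h'.1.1 h.1.2.1 h'.1.2.1 h1
  · exact absurd h.2.1 (h'.2.2 w h.1 h1)

/-- A wedge is the convex hull of its corner and of a walk that cannot be continued. -/
lemma IsWedge.eq_convexHull_of_isWalk (hM : M.IsMesh) (hK : IsWedge M s a b K) {v : Plane}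
    {L : Finset Plane} (hW : IsWalk M s a K v L) (hend : ∀ w, ShortEdge M s v w → w ∉ K) :
    K = convexHull ℝ (insert s (L : Set Plane)) := by
  refine hK.eq_convexHull hM hW.a_mem (fun u hu => (hW.subset u hu).1)
    (fun u hu => (hW.subset u hu).2) fun u hu c hc => ?_
  rcases hW.step u hu with rfl | ⟨w, hw, hs⟩
  · exact absurd hc.2.1 (hend c hc.1)
  · rwa [hc.unique hs]

/-- The vertices beyond the ray of `v` that belong to some region of the family. -/
noncomputable def alive (M : PlaneGraph) (s : Plane) (G : Finset (Set Plane)) (v : Plane) :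
    Finset Plane :=
  M.verts.filter fun z => 0 < orient s v z ∧ ∃ K ∈ G, z ∈ K

/-- The farthest vertex joined to `v` by a short edge, among those in a region of the family. -/
lemma exists_farthest (M : PlaneGraph) (s : Plane) (G : Finset (Set Plane)) (v : Plane) :
    (∀ K ∈ G, ∀ w, ShortEdge M s v w → w ∉ K) ∨
    ∃ w, ShortEdge M s v w ∧ (∃ K ∈ G, w ∈ K) ∧ w ∈ alive M s G v ∧
      ∀ K ∈ G, w ∈ K → IsStep M s K v w := by
  by_cases h : ∀ K ∈ G, ∀ w, ShortEdge M s v w → w ∉ K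
  · exact Or.inl h
  push Not at h
  obtain ⟨K, hK, w, hw, hwK⟩ := h
  obtain ⟨w, hw, hmax⟩ := (M.verts.filter fun w => ShortEdge M s v w ∧ ∃ K ∈ G, w ∈ K)
    |>.exists_max_image (radialSlope s v)
      ⟨w, Finset.mem_filter.2 ⟨mem_verts_right hw.1, hw, K, hK, hwK⟩⟩
  obtain ⟨hwV, hw, hwG⟩ := Finset.mem_filter.1 hw
  refine Or.inr ⟨w, hw, hwG, Finset.mem_filter.2 ⟨hwV, hw.2.1, hwG⟩, fun K hK hwK =>
    ⟨hw, hwK, fun w' hw' hlt hw'K => ?_⟩⟩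
  have h1 := hmax w' (Finset.mem_filter.2 ⟨mem_verts_right hw'.1, hw', K, hK, hw'K⟩)
  have h2 := (orient_pos_iff_radialSlope hw.2.1 hw'.2.1).1 hlt
  linarith

lemma alive_subset {G G' : Finset (Set Plane)} (hG : G' ⊆ G) (v : Plane) :
    alive M s G' v ⊆ alive M s G v := by
  intro z hz
  obtain ⟨h1, h2, K, hK, h3⟩ := Finset.mem_filter.1 hz
  exact Finset.mem_filter.2 ⟨h1, h2, K, hG hK, h3⟩

lemma alive_subset_of_step {G : Finset (Set Plane)} (hG : ∀ K ∈ G, IsWedge M s a b K) {v w : Plane}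
    (hv : ∀ K ∈ G, v ∈ K) (hw : ∀ K ∈ G, w ∈ K) (hvw : 0 < orient s v w) :
    alive M s G w ⊆ alive M s G v := by
  intro z hz
  obtain ⟨h1, h2, K, hK, h3⟩ := Finset.mem_filter.1 hz
  exact Finset.mem_filter.2 ⟨h1, (hG K hK).trans (hv K hK) (hw K hK) h3 hvw h2, K, hK, h3⟩

lemma notMem_alive_self (G : Finset (Set Plane)) (v : Plane) : v ∉ alive M s G v := by
  simp [alive]

/-- Wedges that share the initial part of their walks, up to the vertex `v`, are counted by a
Fibonacci number. The wedges that contain the farthest available successor `w` of `v` and those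
that do not are counted separately. Both families have lost `w`. If `z` is the farthest available
successor of `w`, then either `z` is the nearest later neighbour of `w`, and all wedges of the first
family contain `z`, or all wedges that contain `z` also contain `w`, and the second family
has lost `z`. -/
theorem card_le_fib (hM : M.IsMesh) (m : ℕ) : ∀ (G : Finset (Set Plane)) (v : Plane)
    (L : Finset Plane), (∀ K ∈ G, IsWedge M s a b K) → (∀ K ∈ G, IsWalk M s a K v L) →
    (alive M s G v).card ≤ m → G.card ≤ Nat.fib (m + 2) := by
  induction m using Nat.strong_induction_on with
  | _ m ih =>
  intro G v L hG hW hm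
  have hone : ∀ (G : Finset (Set Plane)) (v : Plane) (L : Finset Plane),
      (∀ K ∈ G, IsWedge M s a b K) → (∀ K ∈ G, IsWalk M s a K v L) →
      (∀ K ∈ G, ∀ w, ShortEdge M s v w → w ∉ K) → G.card ≤ 1 := by
    intro G v L hG hW h
    refine Finset.card_le_one.2 fun K hK K' hK' => ?_
    rw [(hG K hK).eq_convexHull_of_isWalk hM (hW K hK) (h K hK),
      (hG K' hK').eq_convexHull_of_isWalk hM (hW K' hK') (h K' hK')]
  have hfib : 1 ≤ Nat.fib (m + 2) := Nat.fib_pos.2 (by omega)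
  rcases exists_farthest M s G v with h | ⟨w, hvw, -, hwa, hstep⟩
  · exact (hone G v L hG hW h).trans hfib
  have hvK : ∀ K ∈ G, v ∈ K := fun K hK => ((hW K hK).subset v (hW K hK).v_mem).1
  have hm1 : 1 ≤ m := (Finset.card_pos.2 ⟨w, hwa⟩).trans_le hm
  obtain ⟨k, rfl⟩ : ∃ k, m = k + 1 := ⟨m - 1, by omega⟩
  -- the two subfamilies
  set G₁ := G.filter fun K => w ∈ K with hG₁
  set G₀ := G.filter fun K => w ∉ K with hG₀
  have hsplit : G₁.card + G₀.card = G.card := Finset.card_filter_add_card_filter_not _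
  have hsub₁ : G₁ ⊆ G := Finset.filter_subset _ _
  have hsub₀ : G₀ ⊆ G := Finset.filter_subset _ _
  have hwK : ∀ K ∈ G₁, w ∈ K := fun K hK => (Finset.mem_filter.1 hK).2
  have hwed₁ : ∀ K ∈ G₁, IsWedge M s a b K := fun K hK => hG K (hsub₁ hK)
  have hW₁ : ∀ K ∈ G₁, IsWalk M s a K w (insert w L) := fun K hK =>
    (hW K (hsub₁ hK)).extend (hstep K (hsub₁ hK) (hwK K hK))
  have hal₁ : alive M s G₁ w ⊆ alive M s G v :=
    (alive_subset_of_step hwed₁ (fun K hK => hvK K (hsub₁ hK)) hwK hvw.2.1).trans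
      (alive_subset hsub₁ v)
  have hal₀ : alive M s G₀ v ⊆ alive M s G v := alive_subset hsub₀ v
  have hw₀ : w ∉ alive M s G₀ v := by
    intro h
    obtain ⟨-, -, K, hK, h⟩ := Finset.mem_filter.1 h
    exact (Finset.mem_filter.1 hK).2 h
  have hlose₁ : (alive M s G₁ w).card ≤ k := by
    have := Finset.card_lt_card ((Finset.ssubset_iff_of_subset hal₁).2
      ⟨w, hwa, notMem_alive_self _ _⟩)
    omega
  have hlose₀ : (alive M s G₀ v).card ≤ k := by
    have := Finset.card_lt_card ((Finset.ssubset_iff_of_subset hal₀).2 ⟨w, hwa, hw₀⟩)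
    omega
  have hc₁ : G₁.card ≤ Nat.fib (k + 2) := ih k (by omega) G₁ w _ hwed₁ hW₁ hlose₁
  have hc₀ : G₀.card ≤ Nat.fib (k + 2) := ih k (by omega) G₀ v L (fun K hK => hG K (hsub₀ hK))
    (fun K hK => hW K (hsub₀ hK)) hlose₀
  have hrec : Nat.fib (k + 1 + 2) = Nat.fib (k + 1) + Nat.fib (k + 2) := Nat.fib_add_two
  have hfib1 : 1 ≤ Nat.fib (k + 1) := Nat.fib_pos.2 (by omega)
  rcases exists_farthest M s G₁ w with h | ⟨z, hwz, ⟨K₁, hK₁, hzK₁⟩, hza, hstep'⟩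
  · have := hone G₁ w _ hwed₁ hW₁ h
    omega
  have hza' := hal₁ hza
  have hzw : z ≠ w := by rintro rfl; simpa using hwz.2.1
  have htwo : ∀ A ⊆ alive M s G v, w ∉ A → z ∉ A → A.card + 2 ≤ k + 1 := by
    intro A hA hw hz
    have h1 : insert z (insert w A) ⊆ alive M s G v := by
      intro y hy
      rcases Finset.mem_insert.1 hy with rfl | hy
      · exact hza'
      rcases Finset.mem_insert.1 hy with rfl | hy
      · exact hwa
      · exact hA hy
    have h2 := Finset.card_le_card h1
    rw [Finset.card_insert_of_notMem (by simp [hzw, hz]), Finset.card_insert_of_notMem hw] at h2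
    omega
  have hwV : w ∈ M.verts := mem_verts_right hvw.1
  have hnear : ∀ K ∈ G₁, ∃ o ∈ K, ∃ x ∈ K, LeftFace M w o x ∧ 0 < orient s w o ∧
      orient s w x ≤ 0 := fun K hK => (hwed₁ K hK).exists_nearest hM hwV (hwK K hK)
        ((hwed₁ K₁ hK₁).pos_right (hwK K₁ hK₁) hzK₁ hwz.2.1)
  obtain ⟨x, hxK, hF⟩ := (hwed₁ K₁ hK₁).exists_front hM hwz.1 (hwK K₁ hK₁) hzK₁ hwz.2.1
  rcases le_or_gt (orient s w x) 0 with hwx | hwx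
  · -- `z` is the nearest later neighbour of `w`
    have hall : ∀ K ∈ G₁, z ∈ K := by
      intro K hK
      obtain ⟨o, hoK, y, -, hFo, hwo, hwy⟩ := hnear K hK
      rcases hF.nearest hwz.2.1 hwx hFo.adj hwo with h1 | h1
      · exact h1 ▸ hoK
      rcases hFo.nearest hwo hwy hF.adj hwz.2.1 with h2 | h2
      · exact h2 ▸ hoK
      · rw [orient_swap] at h2; linarith
    have hal₂ : alive M s G₁ z ⊆ alive M s G₁ w :=
      alive_subset_of_step hwed₁ hwK hall hwz.2.1
    have h2 := htwo _ (hal₂.trans hal₁) (fun h => notMem_alive_self _ _ (hal₂ h))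
      (notMem_alive_self _ _)
    obtain ⟨j, rfl⟩ : ∃ j, k = j + 1 := ⟨k - 1, by omega⟩
    have : G₁.card ≤ Nat.fib (j + 1 + 1) := ih j (by omega) G₁ z (insert z (insert w L)) hwed₁
      (fun K hK => (hW₁ K hK).extend (hstep' K hK (hall K hK))) (by omega)
    omega
  · -- the face in front of the edge `w z` extends forward to the ray of `z`
    have hzx : 0 ≤ orient s z x := by
      by_contra h
      push Not at h
      exact hwz.2.2 ⟨x, hF, hwx, by
        have : orient s x z = -orient s z x := by unfold orient; ring
        rw [this]; linarith⟩
    have hz₀ : z ∉ alive M s G₀ v := by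
      intro h
      obtain ⟨-, -, K, hK, hzK⟩ := Finset.mem_filter.1 h
      refine (Finset.mem_filter.1 hK).2
        ((hG K (hsub₀ hK)).mem_of_leftFace hF hwz.2.1 hzx ?_ hzK)
      exact (hwed₁ K₁ hK₁).pos_left (hwK K₁ hK₁) hzK₁ hwz.2.1
    have h2 := htwo _ hal₀ hw₀ hz₀
    obtain ⟨j, rfl⟩ : ∃ j, k = j + 1 := ⟨k - 1, by omega⟩
    have : G₀.card ≤ Nat.fib (j + 1 + 1) := ih j (by omega) G₀ v L (fun K hK => hG K (hsub₀ hK))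
      (fun K hK => hW K (hsub₀ hK)) (by omega)
    omega

/-! ### Regions are wedges -/

/-- A finite set has a point `s` such that all its other points lie strictly on one side of a line
through `s`. -/
lemma exists_corner {X : Finset Plane} (hX : X.Nonempty) :
    ∃ s ∈ X, ∃ z : Plane, ∀ q ∈ X, q ≠ s → 0 < orient z s q := by
  -- take a point of largest norm, and the tangent at this point to the circle around the origin
  obtain ⟨s, hs, hmax⟩ := X.exists_max_image (fun p => (p 0) ^ 2 + (p 1) ^ 2) hX
  refine ⟨s, hs, !₂[s 0 + s 1, s 1 - s 0], fun q hq hqs => ?_⟩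
  have h1 := hmax q hq
  have h2 : 0 < (q 0 - s 0) ^ 2 + (q 1 - s 1) ^ 2 := by
    by_contra h
    have h0 : q 0 - s 0 = 0 := by nlinarith [sq_nonneg (q 0 - s 0), sq_nonneg (q 1 - s 1)]
    have h1 : q 1 - s 1 = 0 := by nlinarith [sq_nonneg (q 0 - s 0), sq_nonneg (q 1 - s 1)]
    exact hqs (plane_ext (by linarith) (by linarith))
  unfold orient; simp; nlinarith

lemma IsRegion.exists_isWedge {K : Set Plane} (hK : IsRegion M K) (hi : (interior K).Nonempty) :
    ∃ s ∈ M.verts, ∃ a ∈ M.verts, ∃ b ∈ M.verts, IsWedge M s a b K := by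
  set X : Finset Plane := M.verts.filter fun p => p ∈ K with hX
  have hXK : ((X : Set Plane)) = K ∩ M.verts := by ext p; simp [hX, and_comm]
  have hull : convexHull ℝ (X : Set Plane) = K := by rw [hXK]; exact hK.hull_eq
  have hmem : ∀ u ∈ X, u ∈ M.verts ∧ u ∈ K := fun u hu => Finset.mem_filter.1 hu
  have hflat : ∀ p q : Plane, p ≠ q → ¬ ∀ r ∈ X, orient p q r = 0 := by
    intro p q hpq h
    have := interior_convexHull_eq_empty hpq (A := (X : Set Plane)) h
    rw [hull] at this
    exact hi.ne_empty this
  have hXne : X.Nonempty := by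
    by_contra h
    obtain ⟨p, q, hpq⟩ := exists_pair_ne Plane
    exact hflat p q hpq fun r hr => absurd ⟨r, hr⟩ h
  obtain ⟨s, hs, z, hz⟩ := exists_corner hXne
  set Y := X.erase s with hY
  have hYX : ∀ u ∈ Y, u ∈ X ∧ 0 < orient z s u := fun u hu =>
    ⟨Finset.mem_of_mem_erase hu, hz u (Finset.mem_of_mem_erase hu) (Finset.ne_of_mem_erase hu)⟩
  have hYne : Y.Nonempty := by
    by_contra h
    obtain ⟨q, hq⟩ := exists_ne s
    refine hflat s q hq.symm fun r hr => ?_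
    by_cases hrs : r = s
    · simp [hrs]
    · exact absurd ⟨r, Finset.mem_erase.2 ⟨hrs, hr⟩⟩ h
  obtain ⟨a, ha, hamax⟩ := Y.exists_max_image
    (fun u => toLex (radialSlope z s u, orient z s u)) hYne
  obtain ⟨b, hb, hbmin⟩ := Y.exists_min_image (radialSlope z s) hYne
  obtain ⟨haX, haz⟩ := hYX a ha
  obtain ⟨hbX, hbz⟩ := hYX b hb
  have hle : ∀ u ∈ Y, radialSlope z s u < radialSlope z s a ∨
      (radialSlope z s u = radialSlope z s a ∧ orient z s u ≤ orient z s a) := by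
    intro u hu
    have := hamax u hu
    rwa [Prod.Lex.toLex_le_toLex] at this
  have hleft : ∀ u ∈ X, 0 < orient s a u ∨ (orient s a u = 0 ∧ orient z s u ≤ orient z s a) := by
    intro u hu
    by_cases hus : u = s
    · right; simp [hus, haz.le]
    have huY : u ∈ Y := Finset.mem_erase.2 ⟨hus, hu⟩
    obtain ⟨c, hc, he⟩ := orient_eq_radialSlope (hYX u huY).2 haz
    rcases hle u huY with h | ⟨h, h'⟩
    · left; rw [he]; exact mul_pos hc (by linarith)
    · right; rw [he, h]; simpa using h'
  have hright : ∀ u ∈ X, 0 ≤ orient b s u := by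
    intro u hu
    by_cases hus : u = s
    · simp [hus]
    have huY : u ∈ Y := Finset.mem_erase.2 ⟨hus, hu⟩
    obtain ⟨c, hc, he⟩ := orient_eq_radialSlope hbz (hYX u huY).2
    rw [← orient_cycle, he]
    exact mul_nonneg hc.le (by linarith [hbmin u huY])
  have hsa : s ≠ a := (Finset.ne_of_mem_erase ha).symm
  have hcone : ∀ k ∈ K, 0 ≤ orient s a k := by
    intro k hk
    rw [← hull] at hk
    refine convexHull_min (fun u hu => ?_) (convex_orient_nonneg s a) hk
    rcases hleft u hu with h | h
    · exact h.le
    · exact h.1.ge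
  refine ⟨s, (hmem s hs).1, a, (hmem a haX).1, b, (hmem b hbX).1, hK, (hmem s hs).2,
    (hmem a haX).2, (hmem b hbX).2, (hmem a haX).1, (hmem b hbX).1, ?_, hcone, ?_, ?_⟩
  · refine (hcone b (hmem b hbX).2).lt_of_ne fun h0 => hflat s a hsa fun u hu => ?_
    by_cases hus : u = s
    · simp [hus]
    have huY : u ∈ Y := Finset.mem_erase.2 ⟨hus, hu⟩
    obtain ⟨c, hc, he⟩ := orient_eq_radialSlope hbz haz
    obtain ⟨c', hc', he'⟩ := orient_eq_radialSlope (hYX u huY).2 haz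
    rw [he] at h0
    have h1 := (mul_eq_zero.1 h0.symm).resolve_left hc.ne'
    have h2 := hbmin u huY
    have h3 : radialSlope z s u ≤ radialSlope z s a := by
      rcases hle u huY with h | h
      · exact h.le
      · exact h.1.le
    have h4 : radialSlope z s a - radialSlope z s u = 0 := by linarith
    rw [he', h4, mul_zero]
  · intro k hk
    rw [← hull] at hk
    rw [← orient_cycle, ← orient_cycle]
    exact convexHull_min (fun u hu => hright u hu) (convex_orient_nonneg b s) hk
  · -- all vertices lie to the left of the line `s a`, or on it but not beyond `a`
    intro t ht hmemK
    have hconv : Convex ℝ {q | 0 < orient s a q ∨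
        (orient s a q = 0 ∧ orient z s q ≤ orient z s a)} := by
      rw [convex_iff_forall_pos]
      intro p hp q hq x y hx hy hxy
      simp only [mem_ofPred_eq] at *
      rw [orient_combo _ _ _ _ hxy, orient_combo _ _ _ _ hxy]
      rcases hp with hp | ⟨hp, hp'⟩ <;> rcases hq with hq | ⟨hq, hq'⟩
      · left; positivity
      · left; rw [hq]; simp; positivity
      · left; rw [hp]; simp; positivity
      · right
        refine ⟨by rw [hp, hq]; simp, ?_⟩
        have h1 := mul_le_mul_of_nonneg_left hp' hx.le
        have h2 := mul_le_mul_of_nonneg_left hq' hy.le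
        have h3 : x * orient z s a + y * orient z s a = orient z s a := by
          rw [← add_mul, hxy, one_mul]
        linarith
    rw [← hull] at hmemK
    have : 0 < orient s a (lineMap s a t) ∨ (orient s a (lineMap s a t) = 0 ∧
        orient z s (lineMap s a t) ≤ orient z s a) :=
      convexHull_min (fun u hu => hleft u hu) hconv hmemK
    simp only [orient_lineMap, orient_self_outer, orient_self_right, mul_zero,
      add_zero, lt_self_iff_false, false_or, zero_add] at this
    nlinarith [this.2]

/-! ### Convex polygons span regions -/

lemma edgeSet_eq_segment {k : ℕ} (P : Polygon Plane k) (i : Fin k) :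
    P.edgeSet ℝ i = segment ℝ (P i) (P (finRotate k i)) := affineSegment_eq_segment ..

lemma adj_of_respects {k : ℕ} {P : Polygon Plane k} (h : P.Respects M) (i : Fin k) :
    M.graph.Adj (P i) (P (finRotate k i)) := h ⟨i, rfl⟩

lemma isRegion_of_isConvex {k : ℕ} {P : Polygon Plane k} (hP : P.IsConvex) (h : P.Respects M) :
    IsRegion M (convexHull ℝ (range P.vertices)) := by
  refine ⟨?_, ?_⟩
  · refine subset_antisymm (convexHull_min inter_subset_left (convex_convexHull ℝ _))
      (convexHull_mono (subset_inter (subset_convexHull ℝ _) ?_))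
    rintro _ ⟨i, rfl⟩
    exact M.mem_verts _ _ (adj_of_respects h i)
  · rw [← hP.boundary_eq]
    intro x hx
    obtain ⟨i, hi⟩ := mem_iUnion.1 hx
    rw [edgeSet_eq_segment] at hi
    exact Or.inr ⟨_, _, adj_of_respects h i, hi⟩

/-- The vertices of a simple polygon are not collinear, because the two sides at an extreme vertex
would overlap. -/
lemma interior_nonempty_of_isSimple {k : ℕ} {P : Polygon Plane k} (hP : P.IsSimple) :
    (interior (convexHull ℝ (range P.vertices))).Nonempty := by
  by_contra hne
  have hcol : ∀ i j l, orient (P i) (P j) (P l) = 0 := by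
    have key : ∀ i j l, ¬ 0 < orient (P i) (P j) (P l) := by
      intro i j l h
      refine hne (Set.Nonempty.mono (interior_mono (convexHull_mono
        (s := {P i, P j, P l}) ?_)) ?_)
      · rintro _ (rfl | rfl | rfl) <;> exact mem_range_self _
      · set c : Plane := (1 / 3 : ℝ) • P i + (1 / 3 : ℝ) • P j + (1 / 3 : ℝ) • P l with hc
        refine ⟨c, (mem_interior_triangle h).2 ⟨?_, ?_, ?_⟩⟩ <;>
          rw [hc, orient_combo_three _ _ _ _ _ (by norm_num)] <;>
          simp only [orient_self_outer, orient_self_right, mul_zero, zero_add, add_zero]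
        · linarith
        · rw [orient_cycle]; linarith
        · rw [orient_cycle, orient_cycle]; linarith
    intro i j l
    have h1 := key i j l
    have h2 := key i l j
    rw [orient_swap] at h2
    linarith
  obtain ⟨m, rfl⟩ : ∃ m, k = m + 3 := ⟨k - 3, by have := hP.three_le; omega⟩
  obtain ⟨s, hs, z, hz⟩ := exists_corner (X := Finset.univ.image P.vertices)
    ⟨P 0, Finset.mem_image_of_mem _ (Finset.mem_univ _)⟩
  obtain ⟨i, -, rfl⟩ := Finset.mem_image.1 hs
  -- the neighbours of the extreme vertex `P i` are `P j` and `P l`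
  obtain ⟨j, hj⟩ := (finRotate (m + 3)).surjective i
  set l := finRotate (m + 3) i with hl
  have hji : j ≠ i := by
    rintro rfl
    rw [finRotate_apply] at hj
    simp at hj
  have hli : l ≠ i := by
    rw [hl, finRotate_apply]; simp
  have hlj : l ≠ j := by
    rw [hl, ← hj, finRotate_apply, finRotate_apply, add_assoc]
    intro h
    have h2 : (1 + 1 : Fin (m + 3)) = 0 := by simpa using h
    have h3 := congrArg Fin.val h2
    simp [Fin.val_add, Nat.mod_eq_of_lt] at h3
  have hpos : ∀ q, q ≠ i → 0 < orient z (P i) (P q) := fun q hq =>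
    hz _ (Finset.mem_image_of_mem _ (Finset.mem_univ _)) (hP.injective.ne hq)
  have hside := hP.side_side i j hji.symm
  rw [edgeSet_eq_segment, edgeSet_eq_segment, hj, ← hl] at hside
  have hmeet : ∀ p q, p ≠ i → q ≠ i → orient z (P i) (P q) ≤ orient z (P i) (P p) →
      P q ∈ segment ℝ (P i) (P p) := by
    intro p q hp hq hle
    rw [eq_lineMap_of_orient_eq_zero (hpos p hp).ne' (hcol i p q), segment_eq_image_lineMap]
    have := hpos p hp
    have := hpos q hq
    exact ⟨_, ⟨by positivity, (div_le_one (hpos p hp)).2 hle⟩, rfl⟩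
  rcases le_total (orient z (P i) (P j)) (orient z (P i) (P l)) with hle | hle
  · have := (hside ⟨hmeet l j hli hji hle, left_mem_segment ℝ _ _⟩).1
    rcases this with h | h
    · exact hji (hP.injective h)
    · exact hlj (hP.injective h).symm
  · have := (hside ⟨right_mem_segment ℝ _ _, by
      rw [segment_symm]; exact hmeet j l hji hli hle⟩).2
    rcases this with h | h
    · exact hlj (hP.injective h)
    · exact hli (hP.injective h)

/-- The edges of `M` contained in the boundary of a set. -/
def boundaryEdges (M : PlaneGraph) (K : Set Plane) : Set (Sym2 Plane) :=
  {e | e ∈ M.graph.edgeSet ∧ ∀ u w, e = s(u, w) → segment ℝ u w ⊆ frontier K}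

lemma segment_eq_of_sym2_eq {u w u' w' : Plane} (h : s(u, w) = s(u', w')) :
    segment ℝ u w = segment ℝ u' w' := by
  rcases Sym2.eq_iff.1 h with ⟨rfl, rfl⟩ | ⟨rfl, rfl⟩
  · rfl
  · exact segment_symm ..

/-- The sides of a convex polygon are determined by the region that it bounds. -/
lemma sides_eq_boundaryEdges {k : ℕ} {P : Polygon Plane k} (hP : P.IsConvex) (h : P.Respects M) :
    P.sides = boundaryEdges M (convexHull ℝ (range P.vertices)) := by
  ext e
  constructor
  · rintro ⟨i, rfl⟩
    refine ⟨h ⟨i, rfl⟩, fun u w he => ?_⟩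
    rw [← segment_eq_of_sym2_eq he, ← hP.boundary_eq, ← edgeSet_eq_segment]
    exact subset_iUnion (fun i => P.edgeSet ℝ i) i
  · induction e using Sym2.ind with
    | _ u w =>
    rintro ⟨huw, hfr⟩
    have huw : M.graph.Adj u w := huw
    have hseg := hfr u w rfl
    set m : Plane := lineMap u w (1 / 2 : ℝ) with hm
    have hmseg : m ∈ segment ℝ u w := by
      rw [segment_eq_image_lineMap]; exact ⟨1 / 2, by norm_num, rfl⟩
    have hmb := hseg hmseg
    rw [← hP.boundary_eq] at hmb
    obtain ⟨i, hi⟩ := mem_iUnion.1 hmb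
    rw [edgeSet_eq_segment] at hi
    refine ⟨i, ?_⟩
    by_contra hne
    have := (M.edge_edge _ _ u w (adj_of_respects h i) huw hne ⟨hi, hmseg⟩).2
    rcases this with h' | h'
    · rw [hm, lineMap_eq_left_iff] at h'
      rcases h' with h' | h'
      · exact huw.ne h'
      · norm_num at h'
    · have h' : m = w := h'
      rw [hm, lineMap_eq_right_iff] at h'
      rcases h' with h' | h'
      · exact huw.ne h'
      · norm_num at h'

/-! ### The number of convex polygons -/

lemma finite_isWedge (M : PlaneGraph) (s a b : Plane) : {K | IsWedge M s a b K}.Finite := by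
  refine ((M.verts.powerset.finite_toSet).image
    fun X : Finset Plane => convexHull ℝ (X : Set Plane)).subset fun K hK => ?_
  refine ⟨M.verts.filter fun p => p ∈ K,
    Finset.mem_coe.2 (Finset.mem_powerset.2 (Finset.filter_subset _ _)), ?_⟩
  have : (((M.verts.filter fun p => p ∈ K) : Finset Plane) : Set Plane) = K ∩ M.verts := by
    ext p; simp [and_comm]
  simp only [this]
  exact hK.region.hull_eq

lemma card_isWedge_le (hM : M.IsMesh) (s a b : Plane) :
    (finite_isWedge M s a b).toFinset.card ≤ Nat.fib (M.verts.card + 2) := by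
  have hw : ∀ K ∈ (finite_isWedge M s a b).toFinset, IsWedge M s a b K := by
    intro K hK; simpa using hK
  refine card_le_fib (s := s) (a := a) (b := b) hM _ _ a {a} hw (fun K hK => ?_)
    (Finset.card_filter_le _ _)
  refine ⟨by simp, by simp, ?_, ?_⟩
  · intro u hu
    obtain rfl := Finset.mem_singleton.1 hu
    exact ⟨(hw K hK).a_mem, (hw K hK).a_vert⟩
  · intro u hu
    exact Or.inl (Finset.mem_singleton.1 hu)

lemma convexPolygons_subset (M : PlaneGraph) : M.convexPolygons ⊆
    (((M.verts ×ˢ M.verts ×ˢ M.verts).biUnion fun x =>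
      (finite_isWedge M x.1 x.2.1 x.2.2).toFinset.image (boundaryEdges M) :
        Finset (Set (Sym2 Plane))) : Set (Set (Sym2 Plane))) := by
  rintro S ⟨k, P, hP, h, rfl⟩
  obtain ⟨s, hs, a, ha, b, hb, hK⟩ := (isRegion_of_isConvex hP h).exists_isWedge
    (interior_nonempty_of_isSimple hP.simple)
  rw [Finset.mem_coe, Finset.mem_biUnion]
  refine ⟨(s, a, b), by simp [hs, ha, hb], Finset.mem_image.2 ⟨_, ?_,
    (sides_eq_boundaryEdges hP h).symm⟩⟩
  simpa using hK

lemma ncard_convexPolygons_le (hM : M.IsMesh) :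
    M.convexPolygons.ncard ≤ M.verts.card ^ 3 * Nat.fib (M.verts.card + 2) := by
  refine (ncard_le_ncard (convexPolygons_subset M) (Finset.finite_toSet _)).trans ?_
  rw [ncard_coe_finset]
  refine (Finset.card_biUnion_le_card_mul _ _ (Nat.fib (M.verts.card + 2)) fun x _ =>
    Finset.card_image_le.trans (card_isWedge_le hM _ _ _)).trans (le_of_eq ?_)
  rw [Finset.card_product, Finset.card_product]; ring

lemma fib_le_pow (n : ℕ) : (Nat.fib (n + 1) : ℝ) ≤ 1.6181 ^ n := by
  induction n using Nat.twoStepInduction with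
  | zero => simp
  | one => norm_num
  | more n h1 h2 =>
    have h3 : (Nat.fib (n + 2 + 1) : ℝ) = Nat.fib (n + 1) + Nat.fib (n + 1 + 1) := by
      exact_mod_cast Nat.fib_add_two
    have h4 : (0 : ℝ) < 1.6181 ^ n := by positivity
    rw [h3, pow_add]
    rw [pow_succ] at h2
    nlinarith

lemma exists_bound : ∃ C : ℝ, ∀ n : ℕ, (n : ℝ) ^ 3 * Nat.fib (n + 2) ≤ C * 1.62 ^ n := by
  have ht := tendsto_pow_const_mul_const_pow_of_lt_one 3 (r := 1.6181 / 1.62) (by norm_num)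
    (by norm_num)
  obtain ⟨B, hB⟩ := ht.bddAbove_range
  refine ⟨B * 1.6181, fun n => ?_⟩
  have h1 : (n : ℝ) ^ 3 * (1.6181 / 1.62) ^ n ≤ B := hB ⟨n, rfl⟩
  have h2 := fib_le_pow (n + 1)
  have h3 : (0 : ℝ) < 1.62 ^ n := by positivity
  rw [div_pow, ← mul_div_assoc, div_le_iff₀ h3] at h1
  calc (n : ℝ) ^ 3 * Nat.fib (n + 2) ≤ (n : ℝ) ^ 3 * 1.6181 ^ (n + 1) := by gcongr
    _ = (n : ℝ) ^ 3 * 1.6181 ^ n * 1.6181 := by ring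
    _ ≤ B * 1.62 ^ n * 1.6181 := by gcongr
    _ = B * 1.6181 * 1.62 ^ n := by ring

end MeshCount

theorem mainTheorem2 :
    ∃ C : ℝ, ∀ (n : ℕ) (M : PlaneGraph), M.IsMesh → M.verts.card = n →
      M.convexPolygons.Finite ∧ (M.convexPolygons.ncard : ℝ) ≤ C * (1.62 : ℝ) ^ n := by
  obtain ⟨C, hC⟩ := MeshCount.exists_bound
  refine ⟨C, fun n M hM hn => ⟨(Finset.finite_toSet _).subset (MeshCount.convexPolygons_subset M),
    le_trans ?_ (hC n)⟩⟩
  subst hn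
  exact_mod_cast MeshCount.ncard_convexPolygons_le hM
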